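/- Let $G$ be a group generated by a finite family $\Sigma$ of elements, let $S=\Sigma\cup\Sigma^{-1}$ (formal inverses), and let $\pi\colon S^*\to G$ be the map sending a word to the element it represents. A subset of $G$ is called rational (respectively context-free) if it is of the form $\pi(L)$ for a regular (respectively context-free) language $L\subseteq S^*$. A virtually abelian group description of $G$ consists of: an ordered finite basis $B=\{b_1<\dots<b_n\}$ of a free abelian normal subgroup $A$ of finite index in $G$; a finite right transversal $T$ of $A$ in $G$; a finite presentation of the quotient $G/A$; and the finite table which assigns to each pair $(y,z)$ of letters of $(B\cup T)^{\pm1}$ the unique word of the form $b_1^{e_1}\cdots b_n^{e_n}t$ ($e_i\in\mathbb Z$, $t\in T$) that represents $yz$ in $G$. Theorem. (1) If $G$ is virtually abelian, then every context-free subset of $G$ is rational. (2) A rational expression can be computed effectively: there is a single algorithm which, given any virtually abelian group description of any group $G$, any finite list of words over $(B\cup T)^{\pm1}$ whose values $\Sigma$ generate $G$, and any context-free grammar $\Gamma$ with terminal alphabet $S=\Sigma\cup\Sigma^{-1}$, halts and outputs a regular expression $E$ with language $L(E)\subseteq S^*$ such that $\pi(L(E))=\pi(L(\Gamma))$. -/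

import Mathlib

universe u v

/-! ### Words over a generating set, rational and context-free subsets of a group -/

/-- Words over the alphabet `Σ ∪ Σ⁻¹`: the letter `(i, true)` stands for the generator `i` and
`(i, false)` for its formal inverse. -/
abbrev SWord (α : Type*) := List (α × Bool)

/-- The natural projection from words to the group generated by the elements `x i`. -/
def wordEval {G : Type*} [Group G] {α : Type*} (x : α → G) (w : SWord α) : G :=
  (w.map fun a => if a.2 then x a.1 else (x a.1)⁻¹).prod

/-- `L` is the image of a regular language over `Σ ∪ Σ⁻¹`. -/
def IsRationalSubset {G : Type*} [Group G] {α : Type*} (x : α → G) (L : Set G) : Prop :=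
  ∃ R : Language (α × Bool), R.IsRegular ∧ wordEval x '' (R : Set (SWord α)) = L

/-- `L` is the image of a context-free language over `Σ ∪ Σ⁻¹`. -/
def IsContextFreeSubset {G : Type*} [Group G] {α : Type*} (x : α → G) (L : Set G) : Prop :=
  ∃ C : Language (α × Bool), C.IsContextFree ∧ wordEval x '' (C : Set (SWord α)) = L

/-- A group is virtually abelian if it has an abelian subgroup of finite index. -/
def IsVirtuallyAbelian (G : Type*) [Group G] : Prop :=
  ∃ A : Subgroup G, A.FiniteIndex ∧ ∀ a ∈ A, ∀ b ∈ A, a * b = b * a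

/-! ### Finite descriptions of virtually abelian groups -/

/-- Names of the generators `b₀, …, bₙ₋₁` (`Sum.inl i`) and `t₀, …, tₘ₋₁` (`Sum.inr j`). -/
abbrev BTName := ℕ ⊕ ℕ

/-- The raw finite data of a virtually abelian group description. -/
structure VADescription where
  /-- number `n` of elements of the ordered free abelian basis `B` -/
  rank : ℕ
  /-- number `m` of elements of the transversal `T` -/
  index : ℕ
  /-- number of generators in the presentation of the finite quotient -/
  quotGens : ℕ
  /-- relators in the presentation of the finite quotient -/
  quotRels : List (SWord ℕ)
  /-- the graph of the function which sends a pair of letters of `(B ∪ T)^±` to the normal form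
  of their product -/
  table : List (((BTName × Bool) × (BTName × Bool)) × SWord BTName)

/-- The raw finite data of a context-free grammar over the letters `(i, true)`, `(i, false)`.
In the right-hand side of a rule, `Sum.inl` marks a nonterminal and `Sum.inr` a terminal. -/
structure GrammarCode where
  start : ℕ
  rules : List (ℕ × List (ℕ ⊕ (ℕ × Bool)))

namespace VADescription

/-- The names that occur in a description. -/
def IsName (D : VADescription) : BTName → Prop :=
  Sum.elim (fun i => i < D.rank) (fun j => j < D.index)

/-- The normal form word `b₀^{e₀} ⋯ bₙ₋₁^{eₙ₋₁} t_j`. -/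
def normalWord (D : VADescription) (e : Fin D.rank → ℤ) (j : ℕ) : SWord BTName :=
  ((List.finRange D.rank).flatMap fun i =>
    List.replicate (e i).natAbs (Sum.inl i.val, decide (0 ≤ e i))) ++ [(Sum.inr j, true)]

/-- The relators of the presentation, as elements of a free group. -/
def quotRelators (D : VADescription) : Set (FreeGroup (Fin D.quotGens)) :=
  {r | ∃ w : SWord (Fin D.quotGens),
    w.map (fun a => (a.1.val, a.2)) ∈ D.quotRels ∧ r = FreeGroup.mk w}

/-- The subgroup `A` generated by `b₀, …, bₙ₋₁`. -/
def baseSubgroup (D : VADescription) {G : Type*} [Group G] (b : ℕ → G) : Subgroup G :=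
  Subgroup.closure (b '' Set.Iio D.rank)

/-- `D` is a virtually abelian group description of `G`, with `b₀, …, bₙ₋₁` as the basis and
`t₀, …, tₘ₋₁` as the transversal. (Values of `b` and `t` at larger indices play no role.) -/
structure Describes (D : VADescription) {G : Type*} [Group G] (b t : ℕ → G) : Prop where
  basis_comm : ∀ i < D.rank, ∀ j < D.rank, b i * b j = b j * b i
  basis_free : Function.Injective fun e : Fin D.rank → ℤ =>
    (List.ofFn fun i : Fin D.rank => b i ^ e i).prod
  normal : (D.baseSubgroup b).Normal
  transversal_inj : Set.InjOn t (Set.Iio D.index)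
  transversal : Subgroup.IsComplement (D.baseSubgroup b : Set G) (t '' Set.Iio D.index)
  /-- relators are words in the generators of the presentation -/
  quot_letters : ∀ w ∈ D.quotRels, ∀ a ∈ w, a.1 < D.quotGens
  /-- the presented group is isomorphic to `G ⧸ A` -/
  quot : ∃ φ : G →* PresentedGroup D.quotRelators,
    Function.Surjective φ ∧ φ.ker = D.baseSubgroup b
  /-- the table has an entry for every pair of letters -/
  table_total : ∀ a c : BTName × Bool, D.IsName a.1 → D.IsName c.1 → ∃ w, ((a, c), w) ∈ D.table
  /-- every entry of the table is a pair of letters with the normal form of their product -/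
  table_spec : ∀ a c : BTName × Bool, ∀ w : SWord BTName, ((a, c), w) ∈ D.table →
    D.IsName a.1 ∧ D.IsName c.1 ∧
    (∃ (e : Fin D.rank → ℤ) (j : ℕ), j < D.index ∧ w = D.normalWord e j) ∧
    wordEval (Sum.elim b t) w = wordEval (Sum.elim b t) [a, c]

end VADescription

/-- Elements of `G` listed by words over `B ∪ T`: the `i`-th one. -/
def listedElement {G : Type*} [Group G] (b t : ℕ → G) (gens : List (SWord BTName)) (i : ℕ) : G :=
  wordEval (Sum.elim b t) (gens.getD i [])

namespace GrammarCode

/-- The context-free grammar given by a code. -/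
def toGrammar (g : GrammarCode) : ContextFreeGrammar (ℕ × Bool) where
  NT := ℕ
  initial := g.start
  rules := (g.rules.map fun r =>
    (⟨r.1, r.2.map (Sum.elim Symbol.nonterminal Symbol.terminal)⟩ :
      ContextFreeRule (ℕ × Bool) ℕ)).toFinset

/-- All terminals of the grammar are letters of the alphabet `{0, …, k-1}^±`. -/
def IsOver (g : GrammarCode) (k : ℕ) : Prop :=
  ∀ r ∈ g.rules, ∀ a : ℕ × Bool, Sum.inr a ∈ r.2 → a.1 < k

end GrammarCode

/-! ### Codes of the inputs and outputs of algorithms -/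

instance : Primcodable VADescription :=
  Primcodable.ofEquiv
    (ℕ × ℕ × ℕ × List (SWord ℕ) × List (((BTName × Bool) × (BTName × Bool)) × SWord BTName))
    { toFun := fun D => (D.rank, D.index, D.quotGens, D.quotRels, D.table)
      invFun := fun p => ⟨p.1, p.2.1, p.2.2.1, p.2.2.2.1, p.2.2.2.2⟩
      left_inv := fun _ => rfl
      right_inv := fun _ => rfl }

instance : Primcodable GrammarCode :=
  Primcodable.ofEquiv (ℕ × List (ℕ × List (ℕ ⊕ (ℕ × Bool))))
    { toFun := fun g => (g.start, g.rules)
      invFun := fun p => ⟨p.1, p.2⟩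
      left_inv := fun _ => rfl
      right_inv := fun _ => rfl }

namespace RegularExpression

/-- Gödel numbers of regular expressions over the letters `(i, true)`, `(i, false)`. -/
def toCode : RegularExpression (ℕ × Bool) → ℕ
  | zero => 0
  | epsilon => 1
  | char a => 4 * Nat.bit a.2 a.1 + 2
  | plus P Q => 4 * Nat.pair P.toCode Q.toCode + 3
  | comp P Q => 4 * Nat.pair P.toCode Q.toCode + 4
  | star P => 4 * P.toCode + 5

/-- The regular expression with a given Gödel number. -/
def ofCode : ℕ → RegularExpression (ℕ × Bool)
  | 0 => zero
  | 1 => epsilon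
  | n + 2 =>
    have hn : n / 4 < n + 2 := by omega
    have _h1 : (n / 4).unpair.1 < n + 2 := lt_of_le_of_lt (Nat.unpair_left_le _) hn
    have _h2 : (n / 4).unpair.2 < n + 2 := lt_of_le_of_lt (Nat.unpair_right_le _) hn
    match n % 4 with
    | 0 => char (Nat.div2 (n / 4), Nat.bodd (n / 4))
    | 1 => plus (ofCode (n / 4).unpair.1) (ofCode (n / 4).unpair.2)
    | 2 => comp (ofCode (n / 4).unpair.1) (ofCode (n / 4).unpair.2)
    | _ => star (ofCode (n / 4))

theorem ofCode_toCode (P : RegularExpression (ℕ × Bool)) :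
    ofCode P.toCode = P := by
  induction P with
  | zero => simp [toCode, ofCode]
  | epsilon => simp [toCode, ofCode]
  | char a =>
    have h1 : 4 * Nat.bit a.2 a.1 % 4 = 0 := by omega
    have h2 : 4 * Nat.bit a.2 a.1 / 4 = Nat.bit a.2 a.1 := by omega
    simp only [toCode, ofCode, h1, h2, Nat.div2_bit, Nat.bodd_bit]
  | plus P Q hP hQ =>
    have h1 : (4 * Nat.pair P.toCode Q.toCode + 1) % 4 = 1 := by omega
    have h2 : (4 * Nat.pair P.toCode Q.toCode + 1) / 4 = Nat.pair P.toCode Q.toCode := by omega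
    simp only [toCode, ofCode, h1, h2, Nat.unpair_pair, hP, hQ]
  | comp P Q hP hQ =>
    have h1 : (4 * Nat.pair P.toCode Q.toCode + 2) % 4 = 2 := by omega
    have h2 : (4 * Nat.pair P.toCode Q.toCode + 2) / 4 = Nat.pair P.toCode Q.toCode := by omega
    simp only [toCode, ofCode, h1, h2, Nat.unpair_pair, hP, hQ]
  | star P hP =>
    have h1 : (4 * P.toCode + 3) % 4 = 3 := by omega
    have h2 : (4 * P.toCode + 3) / 4 = P.toCode := by omega
    simp only [toCode, ofCode, h1, h2, hP]

theorem toCode_ofCode (n : ℕ) :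
    (ofCode n).toCode = n := by
  induction n using Nat.strong_induction_on with
  | _ n ih =>
    match n with
    | 0 => simp [toCode, ofCode]
    | 1 => simp [toCode, ofCode]
    | n + 2 =>
      have hn : n / 4 < n + 2 := by omega
      have h1 := ih _ (lt_of_le_of_lt (Nat.unpair_left_le (n / 4)) hn)
      have h2 := ih _ (lt_of_le_of_lt (Nat.unpair_right_le (n / 4)) hn)
      have h3 := ih _ hn
      have h4 : n % 4 = 0 ∨ n % 4 = 1 ∨ n % 4 = 2 ∨ n % 4 = 3 := by omega
      rcases h4 with h | h | h | h
      · simp only [ofCode, h, toCode, Nat.bit_bodd_div2]; omega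
      · simp only [ofCode, h, toCode, h1, h2, Nat.pair_unpair]; omega
      · simp only [ofCode, h, toCode, h1, h2, Nat.pair_unpair]; omega
      · simp only [ofCode, h, toCode, h3]; omega

instance : Denumerable (RegularExpression (ℕ × Bool)) :=
  Denumerable.mk' ⟨toCode, ofCode, ofCode_toCode, toCode_ofCode⟩

end RegularExpression

/-! Let `A` be an abelian subgroup of finite index, with words chosen for representatives of its
right cosets. A value `g` of a sentential form, read from the coset of `σ` to the coset of `σ'`, is
`σ⁻¹ a σ'` with `a ∈ A`. Concatenation multiplies the elements `a`, because the inner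
representatives cancel; normality of `A` plays no role here. So the grammar, with its forms cut into
binary productions and annotated by pairs of cosets, becomes a production system with values in the
commutative group `A`.

For such a system Parikh's argument applies. The value of a derivation tree depends only on its
vector of production counts. Two closed trees with the same root and the same set `U` of used
productions, one vector below the other, differ by a balanced vector. By Dickson's lemma there are
finitely many minimal tree vectors for each root and `U`, and finitely many minimal nonzero balanced
vectors, the periods. By `IsBalanced.exists_tree` each period is the vector of a loop, a tree whose
only open leaf carries the label of its root, and a loop can be inserted into any tree that uses all
of `U`. Hence the values form finitely many linear sets `a · P*` (`exists_table`), and in `A` the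
submonoid `P*` is `p₁* ⋯ pₖ*`, which is rational.

The algorithm searches for a table instead of computing one. A certificate is a finite table of
linear sets which is closed under the productions, so that it contains every value, and whose
entries have formal derivations by inserting loops, so that it contains nothing else. Every
certificate yields a correct expression (`yield_iff_of_isCertificate`), and Parikh's theorem
provides one (`exists_certificate`). Being a certificate is semidecidable: it only asserts
equalities in `G` and memberships in `A`, and these are formally derivable whenever they hold, since
the relations of the table already present `G` (`ProvablyEq.of_eval_eq`). An unbounded search
therefore halts. -/

/-! ### Semidecidable predicates -/

/-! ### Composition rules for primitive recursive functions -/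

section FunProp

variable {α β γ : Type*} [Primcodable α] [Primcodable β] [Primcodable γ]

theorem Primrec.fst_comp {f : α → β × γ} (hf : Primrec f) : Primrec fun a => (f a).1 :=
  Primrec.fst.comp hf

theorem Primrec.snd_comp {f : α → β × γ} (hf : Primrec f) : Primrec fun a => (f a).2 :=
  Primrec.snd.comp hf

theorem Primrec.append_comp {f g : α → List β} (hf : Primrec f) (hg : Primrec g) :
    Primrec fun a => f a ++ g a :=
  Primrec.list_append.comp hf hg

theorem Primrec.cons_comp {f : α → β} {g : α → List β} (hf : Primrec f) (hg : Primrec g) :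
    Primrec fun a => f a :: g a :=
  Primrec.list_cons.comp hf hg

theorem Primrec.flatten_comp {f : α → List (List β)} (hf : Primrec f) :
    Primrec fun a => (f a).flatten :=
  Primrec.list_flatten.comp hf

theorem Primrec.length_comp {f : α → List β} (hf : Primrec f) :
    Primrec fun a => (f a).length :=
  Primrec.list_length.comp hf

theorem Primrec.some_comp {f : α → β} (hf : Primrec f) : Primrec fun a => some (f a) :=
  Primrec.option_some.comp hf

theorem Primrec.inl_comp {f : α → β} (hf : Primrec f) :
    Primrec fun a => (Sum.inl (f a) : β ⊕ γ) :=
  Primrec.sumInl.comp hf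

theorem Primrec.inr_comp {f : α → γ} (hf : Primrec f) :
    Primrec fun a => (Sum.inr (f a) : β ⊕ γ) :=
  Primrec.sumInr.comp hf

theorem Primrec.not_comp {f : α → Bool} (hf : Primrec f) : Primrec fun a => !(f a) :=
  Primrec.not.comp hf

attribute [fun_prop] Primrec
attribute [fun_prop] Primrec.id Primrec.const Primrec.comp Primrec.pair Primrec.fst_comp
  Primrec.snd_comp Primrec.append_comp Primrec.cons_comp Primrec.flatten_comp
  Primrec.length_comp Primrec.some_comp Primrec.inl_comp Primrec.inr_comp Primrec.not_comp

end FunProp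

/-- A predicate of the form `∃ n, q (a, n)` with `q` primitive recursive. -/
def SigmaPred {α : Type*} [Primcodable α] (p : α → Prop) : Prop :=
  ∃ q : α × ℕ → Prop, PrimrecPred q ∧ ∀ a, p a ↔ ∃ n, q (a, n)

namespace SigmaPred

variable {α β γ : Type*} [Primcodable α] [Primcodable β] [Primcodable γ]

theorem of_eq {p q : α → Prop} (hp : SigmaPred p) (h : ∀ a, p a ↔ q a) : SigmaPred q := by
  obtain ⟨r, hr, hpr⟩ := hp
  exact ⟨r, hr, fun a => (h a).symm.trans (hpr a)⟩

theorem of_primrecPred {p : α → Prop} (hp : PrimrecPred p) : SigmaPred p :=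
  ⟨fun x => p x.1, hp.comp Primrec.fst, fun a => by simp⟩

theorem comp {p : β → Prop} (hp : SigmaPred p) {f : α → β} (hf : Primrec f) :
    SigmaPred fun a => p (f a) := by
  obtain ⟨q, hq, hpq⟩ := hp
  exact ⟨fun x => q (f x.1, x.2), hq.comp (by fun_prop), fun a => hpq (f a)⟩

/-- A single number codes both the element `b` and its witness. Decoding yields at most one `b`, so
the quantifier over `b` becomes a bounded one over a list. -/
theorem ex {p : α → β → Prop} (hp : SigmaPred fun x : α × β => p x.1 x.2) :
    SigmaPred fun a => ∃ b, p a b := by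
  obtain ⟨q, hq, hpq⟩ := hp
  have hpq' : ∀ a b, p a b ↔ ∃ n, q ((a, b), n) := fun a b => hpq (a, b)
  refine ⟨fun x => ∃ b ∈ (Encodable.decode (α := β) x.2.unpair.1).toList,
    q ((x.1, b), x.2.unpair.2), ?_, fun a => ?_⟩
  · have h := PrimrecRel.exists_mem_list (R := fun (b : β) (x : α × ℕ) =>
      q ((x.1, b), x.2.unpair.2)) (hq.comp (by
        have := Primrec.unpair
        fun_prop))
    refine h.comp (Primrec.optionToList.comp (Primrec.decode.comp ?_)) Primrec.id
    have := Primrec.unpair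
    fun_prop
  · constructor
    · rintro ⟨b, hb⟩
      obtain ⟨n, hn⟩ := (hpq' a b).1 hb
      exact ⟨Nat.pair (Encodable.encode b) n, b, by simp, by simpa using hn⟩
    · rintro ⟨n, b, -, hb⟩
      exact ⟨b, (hpq' a b).2 ⟨_, hb⟩⟩

theorem and {p q : α → Prop} (hp : SigmaPred p) (hq : SigmaPred q) :
    SigmaPred fun a => p a ∧ q a := by
  obtain ⟨r, hr, hpr⟩ := hp
  obtain ⟨s, hs, hqs⟩ := hq
  have : SigmaPred fun a => ∃ n : ℕ × ℕ, r (a, n.1) ∧ s (a, n.2) :=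
    ex (of_primrecPred ((hr.comp (by fun_prop)).and (hs.comp (by fun_prop))))
  refine this.of_eq fun a => ?_
  rw [hpr, hqs]
  constructor
  · rintro ⟨n, h1, h2⟩
    exact ⟨⟨_, h1⟩, ⟨_, h2⟩⟩
  · rintro ⟨⟨m, h1⟩, ⟨n, h2⟩⟩
    exact ⟨(m, n), h1, h2⟩

theorem or {p q : α → Prop} (hp : SigmaPred p) (hq : SigmaPred q) :
    SigmaPred fun a => p a ∨ q a := by
  obtain ⟨r, hr, hpr⟩ := hp
  obtain ⟨s, hs, hqs⟩ := hq
  refine ⟨fun x => r x ∨ s x, hr.or hs, fun a => ?_⟩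
  simp only [hpr, hqs, exists_or]

/-- Finitely many witnesses have a common strict bound, and that bound is the only number to search
for. -/
theorem ball {p : α → β → Prop} {f : α → List β}
    (hp : SigmaPred fun x : α × β => p x.1 x.2) (hf : Primrec f) :
    SigmaPred fun a => ∀ b ∈ f a, p a b := by
  obtain ⟨q, hq, hpq⟩ := hp
  have hpq' : ∀ a b, p a b ↔ ∃ n, q ((a, b), n) := fun a b => hpq (a, b)
  refine ⟨fun x => ∀ b ∈ f x.1, ∃ n ∈ List.range x.2, q ((x.1, b), n), ?_, fun a => ?_⟩
  · have h1 := PrimrecRel.exists_mem_list (R := fun (n : ℕ) (x : α × β) => q (x, n))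
      (hq.comp (by fun_prop))
    have h2 := PrimrecRel.forall_mem_list (R := fun (b : β) (x : α × ℕ) =>
      ∃ n ∈ List.range x.2, q ((x.1, b), n)) (h1.comp
        (f := fun y : β × α × ℕ => List.range y.2.2)
        (g := fun y : β × α × ℕ => (y.2.1, y.1)) (Primrec.list_range.comp (by fun_prop))
        (by fun_prop))
    exact h2.comp (f := fun x : α × ℕ => f x.1) (by fun_prop) Primrec.id
  · constructor
    · intro h
      have h' : ∀ b ∈ f a, ∃ n, q ((a, b), n) := fun b hb => (hpq' a b).1 (h b hb)
      suffices ∃ n, ∀ b ∈ f a, ∃ k < n, q ((a, b), k) by simpa using this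
      clear h
      generalize f a = l at h'
      induction l with
      | nil => exact ⟨0, by simp⟩
      | cons b l ih =>
        obtain ⟨n, hn⟩ := ih fun c hc => h' c (by simp [hc])
        obtain ⟨m, hm⟩ := h' b (by simp)
        refine ⟨max n (m + 1), fun c hc => ?_⟩
        rcases List.mem_cons.1 hc with rfl | hc
        · exact ⟨m, by simp, hm⟩
        · obtain ⟨k, hk, hk'⟩ := hn c hc
          exact ⟨k, lt_of_lt_of_le hk (le_max_left _ _), hk'⟩
    · rintro ⟨n, hn⟩ b hb
      obtain ⟨k, -, hk⟩ := hn b hb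
      exact (hpq' a b).2 ⟨k, hk⟩

theorem eq {f g : α → β} (hf : Primrec f) (hg : Primrec g) : SigmaPred fun a => f a = g a :=
  of_primrecPred (Primrec.eq.comp hf hg)

theorem mem {f : α → β} {g : α → List β} (hf : Primrec f) (hg : Primrec g) :
    SigmaPred fun a => f a ∈ g a := by
  have h := (PrimrecRel.exists_mem_list (Primrec.eq (α := β))).comp hg hf
  exact (of_primrecPred h).of_eq fun a => by simp

theorem lt {f g : α → ℕ} (hf : Primrec f) (hg : Primrec g) : SigmaPred fun a => f a < g a :=
  of_primrecPred (Primrec.nat_lt.comp hf hg)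

theorem subset {f g : α → List β} (hf : Primrec f) (hg : Primrec g) :
    SigmaPred fun a => f a ⊆ g a :=
  ball (p := fun a b => b ∈ g a) (mem (by fun_prop) (by fun_prop)) hf

/-- A semidecidable relation with a witness for every input has a computable choice function. -/
theorem exists_partrec {p : α → β → Prop} (hp : SigmaPred fun x : α × β => p x.1 x.2) :
    ∃ F : α →. β, Partrec F ∧ (∀ a, ∀ b ∈ F a, p a b) ∧
      ∀ a, (∃ b, p a b) → ∃ b, b ∈ F a := by
  obtain ⟨q, ⟨hd, hq⟩, hpq⟩ := hp
  have hpq' : ∀ a b, p a b ↔ ∃ n, q ((a, b), n) := fun a b => hpq (a, b)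
  -- Stage `n` tests one candidate against one witness; unbounded search returns the first candidate
  -- that passes.
  let f : α → ℕ → Option β := fun a n =>
    (Encodable.decode (α := β) n.unpair.1).bind fun b =>
      if q ((a, b), n.unpair.2) then some b else none
  have hf : Primrec₂ f := by
    have hu := Primrec.unpair
    refine Primrec.option_bind (Primrec.decode.comp (by fun_prop)) ?_
    refine Primrec.ite (PrimrecPred.comp (p := q) ⟨hd, hq⟩ ?_) ?_ ?_ <;> fun_prop
  refine ⟨fun a => Nat.rfindOpt (f a), Partrec.rfindOpt hf.to_comp, fun a b hb => ?_, ?_⟩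
  · obtain ⟨n, hn⟩ := Nat.rfindOpt_spec hb
    simp only [f, Option.mem_def, Option.bind_eq_some_iff] at hn
    obtain ⟨c, -, hc⟩ := hn
    split_ifs at hc with h
    cases hc
    exact (hpq' a _).2 ⟨_, h⟩
  · rintro a ⟨b, hb⟩
    obtain ⟨n, hn⟩ := (hpq' a b).1 hb
    have : (Nat.rfindOpt (f a)).Dom := by
      rw [Nat.rfindOpt_dom]
      exact ⟨Nat.pair (Encodable.encode b) n, b, by simp [f, hn]⟩
    exact ⟨_, Part.get_mem this⟩

end SigmaPred

/-! ### Inductively generated relations -/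

/-- The closure of the rules `R premises conclusion`. -/
inductive Derivable {J : Type*} (R : List J → J → Prop) : J → Prop
  | intro (l : List J) (j : J) (hl : ∀ x ∈ l, Derivable R x) (h : R l j) : Derivable R j

/-- A derivation tree is flattened to a list of steps, each carrying its premises, its conclusion
and a witness that the rule applies. Checking that every premise was proved before is a primitive
recursive fold, so only the list has to be searched for. -/
theorem SigmaPred.derivable {α J : Type*} [Primcodable α] [Primcodable J]
    {R : α → List J → J → Prop} (hR : SigmaPred fun x : α × List J × J => R x.1 x.2.1 x.2.2) :
    SigmaPred fun x : α × J => Derivable (R x.1) x.2 := by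
  classical
  obtain ⟨q, ⟨hd, hq⟩, hRq⟩ := hR
  have hRq' : ∀ a l j, R a l j ↔ ∃ n, q ((a, l, j), n) := fun a l j => hRq (a, l, j)
  -- a derivation is a list of steps, the last step first
  let step : α → (List J × J × ℕ) × (List J × Bool) → List J × Bool := fun a x =>
    (x.1.2.1 :: x.2.1, x.2.2 && (decide (q ((a, x.1.1, x.1.2.1), x.1.2.2)) &&
      decide (∀ y ∈ x.1.1, y ∈ x.2.1)))
  let run : α → List (List J × J × ℕ) → List J × Bool := fun a d =>
    d.foldr (fun b s => step a (b, s)) ([], true)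
  have hsub : PrimrecPred fun x : List J × List J => ∀ y ∈ x.1, y ∈ x.2 := by
    have h1 : PrimrecRel fun (y : J) (l : List J) => y ∈ l :=
      ((PrimrecRel.exists_mem_list (Primrec.eq (α := J))).comp Primrec.snd Primrec.fst).of_eq
        fun x => by simp
    exact (PrimrecRel.forall_mem_list h1).comp Primrec.fst Primrec.snd
  have hstep : Primrec₂ step := by
    refine Primrec.pair (by fun_prop) (Primrec.and.comp (by fun_prop) (Primrec.and.comp ?_ ?_))
    · exact hq.comp (f := fun x => decide (q x)) (by fun_prop)
    · have h := hsub.comp (f := fun x : α × (List J × J × ℕ) × (List J × Bool) =>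
        (x.2.1.1, x.2.2.1)) (by fun_prop)
      exact h.decide
  have hrun : Primrec₂ run :=
    Primrec.list_foldr Primrec.snd (Primrec.const _)
      (hstep.comp (Primrec.fst.comp Primrec.fst) Primrec.snd)
  have hsound : ∀ a d, (run a d).2 = true → ∀ j ∈ (run a d).1, Derivable (R a) j := by
    intro a d
    induction d with
    | nil => simp [run]
    | cons s d ih =>
      intro h j hj
      have h' : (run a d).2 = true ∧ q ((a, s.1, s.2.1), s.2.2) ∧
          ∀ y ∈ s.1, y ∈ (run a d).1 := by
        simpa [run, step] using h
      obtain ⟨h1, h2, h3⟩ := h'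
      have hj' : j = s.2.1 ∨ j ∈ (run a d).1 := by simpa [run, step] using hj
      rcases hj' with rfl | hj'
      · exact ⟨s.1, _, fun y hy => ih h1 y (h3 y hy), (hRq' _ _ _).2 ⟨_, h2⟩⟩
      · exact ih h1 j hj'
  -- Valid lists can be concatenated without losing conclusions; this merges the derivations of
  -- several premises.
  have happ : ∀ a d e, (run a e).2 = true → (run a d).2 = true →
      (run a (d ++ e)).2 = true ∧ (∀ j ∈ (run a d).1, j ∈ (run a (d ++ e)).1) ∧
        ∀ j ∈ (run a e).1, j ∈ (run a (d ++ e)).1 := by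
    intro a d e he
    induction d with
    | nil => simp [run, he]
    | cons s d ih =>
      intro h
      have h' : (run a d).2 = true ∧ q ((a, s.1, s.2.1), s.2.2) ∧
          ∀ y ∈ s.1, y ∈ (run a d).1 := by
        simpa [run, step] using h
      obtain ⟨h1, h2, h3⟩ := h'
      obtain ⟨i1, i2, i3⟩ := ih h1
      have e1 : run a (s :: d ++ e) = step a (s, run a (d ++ e)) := rfl
      have e2 : run a (s :: d) = step a (s, run a d) := rfl
      rw [e1, e2]
      refine ⟨?_, ?_, ?_⟩
      · simpa [step, i1, h2] using fun y hy => i2 y (h3 y hy)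
      · intro j hj
        simp only [step, List.mem_cons] at hj ⊢
        exact hj.imp id (i2 j)
      · intro j hj
        simp only [step, List.mem_cons]
        exact Or.inr (i3 j hj)
  have hcomplete : ∀ a j, Derivable (R a) j → ∃ d, (run a d).2 = true ∧ j ∈ (run a d).1 := by
    intro a j h
    induction h with
    | intro l j _ hR ih =>
      have : ∃ d, (run a d).2 = true ∧ ∀ x ∈ l, x ∈ (run a d).1 := by
        clear hR
        induction l with
        | nil => exact ⟨[], by simp [run]⟩
        | cons x l ihl =>
          obtain ⟨d, h1, h2⟩ := ihl (fun y hy => by simp_all) fun y hy => ih y (by simp [hy])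
          obtain ⟨e, h3, h4⟩ := ih x (by simp)
          obtain ⟨i1, i2, i3⟩ := happ a d e h3 h1
          refine ⟨d ++ e, i1, fun y hy => ?_⟩
          rcases List.mem_cons.1 hy with rfl | hy
          · exact i3 _ h4
          · exact i2 _ (h2 y hy)
      obtain ⟨d, h1, h2⟩ := this
      obtain ⟨n, hn⟩ := (hRq' _ _ _).1 hR
      refine ⟨(l, j, n) :: d, ?_, by simp [run, step]⟩
      have : step a ((l, j, n), run a d) = run a ((l, j, n) :: d) := rfl
      rw [← this]
      simpa [step, h1, hn] using h2
  have hmain : SigmaPred fun x : α × J => ∃ d, (run x.1 d).2 = true ∧ x.2 ∈ (run x.1 d).1 :=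
    ex (and (eq (Primrec.snd.comp (hrun.comp (by fun_prop) (by fun_prop))) (by fun_prop))
      (mem (by fun_prop) (Primrec.fst.comp (hrun.comp (by fun_prop) (by fun_prop)))))
  exact hmain.of_eq fun x =>
    ⟨fun ⟨d, h1, h2⟩ => hsound _ d h1 _ h2, fun h => hcomplete _ _ h⟩

/-! ### Parikh's theorem for production systems over a commutative monoid -/

/-- Productions `lhs p → m` and `lhs p → i j`, where `m` is a value. -/
structure ProductionSystem (ι K M : Type*) where
  lhs : ι → K
  body : ι → M ⊕ (K × K)

namespace ProductionSystem

variable {ι K M : Type*} (S : ProductionSystem ι K M)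

/-- The nonterminals on the right-hand side of a production. -/
def rhs (p : ι) : Multiset K := Sum.elim (fun _ => 0) (fun x => {x.1, x.2}) (S.body p)

open Classical in
/-- There is a derivation tree with root `k` and multiset of open leaves `Θ` which uses each
production `p` exactly `ψ p` times. -/
inductive Tree : K → Multiset K → (ι → ℕ) → Prop
  | hole (k : K) : Tree k {k} 0
  | leaf (p : ι) (m : M) (h : S.body p = Sum.inl m) : Tree (S.lhs p) 0 (Pi.single p 1)
  | node (p : ι) (i j : K) (Θ₁ Θ₂ : Multiset K) (ψ₁ ψ₂ : ι → ℕ) (h : S.body p = Sum.inr (i, j))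
      (h₁ : Tree i Θ₁ ψ₁) (h₂ : Tree j Θ₂ ψ₂) :
      Tree (S.lhs p) (Θ₁ + Θ₂) (Pi.single p 1 + (ψ₁ + ψ₂))

variable {S}

open Classical in
-- Applies `p` at one open leaf. The new leaves are left unspecified because the maximality argument
-- in `IsBalanced.exists_tree` looks only at counts; `Tree.extend` does the same above the root.
theorem Tree.expand {k : K} {Θ : Multiset K} {ψ : ι → ℕ} (h : S.Tree k Θ ψ) (p : ι)
    (hp : S.lhs p ∈ Θ) : ∃ Θ', S.Tree k Θ' (Pi.single p 1 + ψ) := by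
  induction h with
  | hole k =>
    obtain rfl := Multiset.mem_singleton.1 hp
    rcases hb : S.body p with m | ⟨i, j⟩
    · exact ⟨_, by simpa using Tree.leaf p m hb⟩
    · exact ⟨_, by simpa using Tree.node p i j _ _ _ _ hb (Tree.hole i) (Tree.hole j)⟩
  | leaf => simp at hp
  | node r i j Θ₁ Θ₂ ψ₁ ψ₂ h h₁ h₂ ih₁ ih₂ =>
    rcases Multiset.mem_add.1 hp with hp | hp
    · obtain ⟨Θ', h'⟩ := ih₁ hp
      have := Tree.node r i j _ _ _ _ h h' h₂
      rw [add_assoc (Pi.single p 1), add_left_comm (Pi.single r 1)] at this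
      exact ⟨_, this⟩
    · obtain ⟨Θ', h'⟩ := ih₂ hp
      have := Tree.node r i j _ _ _ _ h h₁ h'
      rw [add_left_comm ψ₁, add_left_comm (Pi.single r 1)] at this
      exact ⟨_, this⟩

open Classical in
theorem Tree.extend {k : K} {Θ : Multiset K} {ψ : ι → ℕ} (h : S.Tree k Θ ψ) (p : ι)
    (hp : k ∈ S.rhs p) : ∃ Θ', S.Tree (S.lhs p) Θ' (Pi.single p 1 + ψ) := by
  rcases hb : S.body p with m | ⟨i, j⟩
  · simp [rhs, hb] at hp
  · have hk : k = i ∨ k = j := by simpa [rhs, hb] using hp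
    rcases hk with rfl | rfl
    · exact ⟨_, by simpa using Tree.node p _ _ _ _ _ _ hb h (Tree.hole j)⟩
    · exact ⟨_, by simpa using Tree.node p _ _ _ _ _ _ hb (Tree.hole i) h⟩

theorem Tree.exists_lhs_eq {k : K} {Θ : Multiset K} {ψ : ι → ℕ} (h : S.Tree k Θ ψ)
    (hψ : ψ ≠ 0) : ∃ p, ψ p ≠ 0 ∧ S.lhs p = k := by
  cases h with
  | hole => exact absurd rfl hψ
  | leaf p => exact ⟨p, by simp, rfl⟩
  | node p => exact ⟨p, by simp, rfl⟩

variable [Fintype ι]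

variable (S) in
/-- The multiset of left-hand sides of the productions counted by `ψ`. -/
def lhsCount (ψ : ι → ℕ) : Multiset K := ∑ p, ψ p • {S.lhs p}

variable (S) in
/-- The multiset of nonterminals in the right-hand sides of the productions counted by `ψ`. -/
def rhsCount (ψ : ι → ℕ) : Multiset K := ∑ p, ψ p • S.rhs p

variable (S) in
/-- Each nonterminal is produced as often as it is expanded. -/
def IsBalanced (ψ : ι → ℕ) : Prop := S.lhsCount ψ = S.rhsCount ψ

theorem lhsCount_add (ψ φ : ι → ℕ) : S.lhsCount (ψ + φ) = S.lhsCount ψ + S.lhsCount φ := by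
  simp [lhsCount, add_smul, Finset.sum_add_distrib]

theorem rhsCount_add (ψ φ : ι → ℕ) : S.rhsCount (ψ + φ) = S.rhsCount ψ + S.rhsCount φ := by
  simp [rhsCount, add_smul, Finset.sum_add_distrib]

@[simp] theorem lhsCount_zero : S.lhsCount 0 = 0 := by simp [lhsCount]

@[simp] theorem rhsCount_zero : S.rhsCount 0 = 0 := by simp [rhsCount]

open Classical in
@[simp] theorem lhsCount_single (p : ι) : S.lhsCount (Pi.single p 1) = {S.lhs p} := by
  unfold lhsCount
  rw [Finset.sum_eq_single p] <;> simp +contextual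

open Classical in
@[simp] theorem rhsCount_single (p : ι) : S.rhsCount (Pi.single p 1) = S.rhs p := by
  unfold rhsCount
  rw [Finset.sum_eq_single p] <;> simp +contextual

theorem mem_lhsCount {ψ : ι → ℕ} {k : K} :
    k ∈ S.lhsCount ψ ↔ ∃ p, ψ p ≠ 0 ∧ S.lhs p = k := by
  simp only [lhsCount, Multiset.mem_sum, Finset.mem_univ, true_and, Multiset.mem_nsmul,
    Multiset.mem_singleton]
  exact exists_congr fun p => and_congr_right fun _ => eq_comm

theorem mem_rhsCount {ψ : ι → ℕ} {k : K} : k ∈ S.rhsCount ψ ↔ ∃ p, ψ p ≠ 0 ∧ k ∈ S.rhs p := by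
  simp [rhsCount, Multiset.mem_sum, Multiset.mem_nsmul]

/-- Counts the nodes of the tree by label in two ways: each is either expanded or an open leaf, and
each is either the root or produced by a production. -/
theorem Tree.lhsCount_add_eq {k : K} {Θ : Multiset K} {ψ : ι → ℕ} (h : S.Tree k Θ ψ) :
    S.lhsCount ψ + Θ = S.rhsCount ψ + {k} := by
  induction h with
  | hole k => simp
  | leaf p m h => simp [rhs, h]
  | node p i j Θ₁ Θ₂ ψ₁ ψ₂ h h₁ h₂ ih₁ ih₂ =>
    have hr : S.rhs p = {i} + {j} := by simp [rhs, h]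
    simp only [lhsCount_add, rhsCount_add, lhsCount_single, rhsCount_single, hr]
    calc _ = {S.lhs p} + ((S.lhsCount ψ₁ + Θ₁) + (S.lhsCount ψ₂ + Θ₂)) := by abel
      _ = _ := by rw [ih₁, ih₂]; abel

/-- A nonzero balanced count contains the count of a tree with a single open leaf, labelled as its
root. -/
theorem IsBalanced.exists_tree {h : ι → ℕ} (hb : S.IsBalanced h) (h0 : h ≠ 0) :
    ∃ i ψ, ψ ≠ 0 ∧ ψ ≤ h ∧ S.Tree i {i} ψ := by
  classical
  -- Among all nontrivial trees with counts below `h`, whatever their roots and open leaves, one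
  -- with the largest number of productions is chosen.
  let N : Set ℕ := {n | ∃ i Θ ψ, S.Tree i Θ ψ ∧ ψ ≠ 0 ∧ ψ ≤ h ∧ ∑ p, ψ p = n}
  have hbdd : BddAbove N := by
    refine ⟨∑ p, h p, ?_⟩
    rintro n ⟨i, Θ, ψ, -, -, hle, rfl⟩
    exact Finset.sum_le_sum fun p _ => hle p
  have hne : N.Nonempty := by
    obtain ⟨p, hp⟩ := Function.ne_iff.1 h0
    obtain ⟨Θ, hΘ⟩ := (Tree.hole (S := S) (S.lhs p)).expand p (by simp)
    rw [add_zero] at hΘ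
    refine ⟨_, _, _, _, hΘ, by simp, fun q => ?_, rfl⟩
    by_cases hq : q = p
    · subst hq
      simpa [Nat.one_le_iff_ne_zero] using hp
    · simp [hq]
  obtain ⟨i, Θ, ψ, ht, hψ0, hle, hsum⟩ := Nat.sSup_mem hne hbdd
  obtain ⟨q, rfl⟩ := exists_add_of_le hle
  -- By maximality no production left over in `q` can be attached to the tree, neither at an open
  -- leaf nor above the root.
  have hmax : ∀ p, q p ≠ 0 → ∀ k Θ', ¬ S.Tree k Θ' (Pi.single p 1 + ψ) := by
    intro p hp k Θ' ht'
    have hmem : ∑ r, (Pi.single p 1 + ψ : ι → ℕ) r ∈ N := by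
      refine ⟨k, Θ', _, ht', fun h0' => ?_, fun r => ?_, rfl⟩
      · have := congrFun h0' p
        simp at this
      · by_cases hr : r = p
        · subst hr
          simp only [Pi.add_apply, Pi.single_eq_same]
          omega
        · simp [hr]
    have := le_csSup hbdd hmem
    rw [← hsum] at this
    simp [Finset.sum_add_distrib] at this
  have h1 : ∀ k ∈ Θ, k ∉ S.lhsCount q := by
    rintro k hk hkq
    obtain ⟨p, hp, rfl⟩ := mem_lhsCount.1 hkq
    obtain ⟨Θ', h'⟩ := ht.expand p hk
    exact hmax p hp _ _ h'
  have h2 : i ∉ S.rhsCount q := by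
    intro hi
    obtain ⟨p, hp, hip⟩ := mem_rhsCount.1 hi
    obtain ⟨Θ', h'⟩ := ht.extend p hip
    exact hmax p hp _ _ h'
  have hbal := ht.lhsCount_add_eq
  have hb' : S.lhsCount ψ + S.lhsCount q = S.rhsCount ψ + S.rhsCount q := by
    rw [← lhsCount_add, ← rhsCount_add]
    exact hb
  -- Subtracting the count identity of the tree from the balance of `h`. As the root `i` is not
  -- produced in `q`, it must be an open leaf.
  have hkey : Θ + S.rhsCount q = {i} + S.lhsCount q := by
    apply add_left_cancel (a := S.lhsCount ψ + S.rhsCount ψ)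
    calc _ = (S.lhsCount ψ + Θ) + (S.rhsCount ψ + S.rhsCount q) := by abel
      _ = (S.rhsCount ψ + {i}) + (S.lhsCount ψ + S.lhsCount q) := by rw [hbal, hb']
      _ = _ := by abel
  have hi : i ∈ Θ := by
    have : i ∈ Θ + S.rhsCount q := by rw [hkey]; simp
    exact (Multiset.mem_add.1 this).resolve_right h2
  obtain ⟨Θ₂, rfl⟩ := Multiset.exists_cons_of_mem hi
  have hkey' : Θ₂ + S.rhsCount q = S.lhsCount q := by
    apply add_left_cancel (a := ({i} : Multiset K))
    rw [← hkey, ← add_assoc, Multiset.singleton_add]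
  -- After cancelling `i`, any further open leaf would be expanded by a production of `q`, which
  -- maximality forbids.
  have h3 : Θ₂ = 0 := by
    refine Multiset.eq_zero_of_forall_notMem fun k hk => h1 k (by simp [hk]) ?_
    rw [← hkey']
    simp [hk]
  subst h3
  exact ⟨i, ψ, hψ0, hle, ht⟩

variable [CommMonoid M]

variable (S) in
/-- The contribution of a production to the value of a tree. -/
def weight (p : ι) : M := Sum.elim id (fun _ => 1) (S.body p)

variable (S) in
/-- The value of a tree with production counts `ψ`. -/
def value (ψ : ι → ℕ) : M := ∏ p, S.weight p ^ ψ p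

theorem value_add (ψ φ : ι → ℕ) : S.value (ψ + φ) = S.value ψ * S.value φ := by
  simp [value, pow_add, Finset.prod_mul_distrib]

@[simp] theorem value_zero : S.value 0 = 1 := by simp [value]

open Classical in
@[simp] theorem value_single (p : ι) : S.value (Pi.single p 1) = S.weight p := by
  unfold value
  rw [Finset.prod_eq_single p] <;> simp +contextual

/-- Closure properties of a predicate `Low k c P a`, which certifies that all products of `a` with
products of elements of `P` are values of trees with root `k` (and with open leaf `i`, if
`c = some i`). -/
structure IsLower (S : ProductionSystem ι K M) [DecidableEq M]
    (Low : K → Option K → Finset M → M → Prop) : Prop where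
  leaf : ∀ p m, S.body p = Sum.inl m → Low (S.lhs p) none ∅ m
  hole : ∀ k, Low k (some k) ∅ 1
  left : ∀ p i j, S.body p = Sum.inr (i, j) → ∀ c P a Q b, Low i c P a → Low j none Q b →
    Low (S.lhs p) c (P ∪ Q) (a * b)
  right : ∀ p i j, S.body p = Sum.inr (i, j) → ∀ c P a Q b, Low i none P a → Low j c Q b →
    Low (S.lhs p) c (P ∪ Q) (a * b)
  pump : ∀ k P a m, Low k none P a → Low k (some k) ∅ m → Low k none (insert m P) a

/-! ### From trees to certified linear sets -/

section Lower

variable [DecidableEq M] {Low : K → Option K → Finset M → M → Prop}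

/-- Every used production `p` labels a node of the tree with `lhs p`, and there the loops in `F (lhs
p)` can be pumped. They are added node by node along the tree. -/
theorem Tree.lower_of_closed (hL : IsLower S Low) {F : K → Finset M}
    (hF : ∀ k, ∀ m ∈ F k, Low k (some k) ∅ m) {k : K} {Θ : Multiset K} {ψ : ι → ℕ}
    (h : S.Tree k Θ ψ) (hΘ : Θ = 0) :
    Low k none ((Finset.univ.filter fun p => ψ p ≠ 0).biUnion fun p => F (S.lhs p))
      (S.value ψ) := by
  classical
  have hadd : ∀ k P a, Low k none P a → Low k none (F k ∪ P) a := by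
    intro k P a h
    have : ∀ Q ⊆ F k, Low k none (Q ∪ P) a := by
      intro Q
      induction Q using Finset.induction_on with
      | empty => simpa using h
      | insert m Q _ ih =>
        intro hQ
        rw [Finset.insert_union]
        exact hL.pump _ _ _ _ (ih fun x hx => hQ (by simp [hx])) (hF _ _ (hQ (by simp)))
    exact this _ le_rfl
  induction h with
  | hole k => simp at hΘ
  | leaf p m h =>
    convert hadd _ _ _ (hL.leaf p m h) using 1
    · ext x
      simp [Pi.single_apply]
    · simp [weight, h]
  | node p i j Θ₁ Θ₂ ψ₁ ψ₂ h h₁ h₂ ih₁ ih₂ =>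
    obtain ⟨rfl, rfl⟩ : Θ₁ = 0 ∧ Θ₂ = 0 := by simpa using hΘ
    convert hadd _ _ _ (hL.left p i j h _ _ _ _ _ (ih₁ rfl) (ih₂ rfl)) using 1
    · ext x
      simp only [Finset.mem_biUnion, Finset.mem_filter, Finset.mem_univ, true_and, ne_eq,
        Pi.add_apply, Finset.mem_union, Pi.single_apply, Nat.add_eq_zero_iff]
      constructor
      · rintro ⟨r, hr, hx⟩
        by_cases hrp : r = p
        · subst hrp
          exact Or.inl hx
        · by_cases hr1 : ψ₁ r = 0
          · exact Or.inr (Or.inr ⟨r, by simpa [hrp, hr1] using hr, hx⟩)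
          · exact Or.inr (Or.inl ⟨r, hr1, hx⟩)
      · rintro (hx | ⟨r, hr, hx⟩ | ⟨r, hr, hx⟩)
        · exact ⟨p, by simp, hx⟩
        · exact ⟨r, by tauto, hx⟩
        · exact ⟨r, by tauto, hx⟩
    · simp [value_add, weight, h]

/-- Such a tree is a path to its open leaf with closed trees hanging off it. The closed ones are
certified without periods, by `Tree.lower_of_closed` with `F` empty. -/
theorem Tree.lower_of_context (hL : IsLower S Low) {k i : K} {Θ : Multiset K} {ψ : ι → ℕ}
    (h : S.Tree k Θ ψ) (hΘ : Θ = {i}) : Low k (some i) ∅ (S.value ψ) := by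
  classical
  have hclosed : ∀ {k Θ ψ}, S.Tree k Θ ψ → Θ = 0 → Low k none ∅ (S.value ψ) := by
    intro k Θ ψ h hΘ
    convert h.lower_of_closed hL (F := fun _ => ∅) (by simp) hΘ using 1
    ext x
    simp
  induction h with
  | hole k =>
    obtain rfl := Multiset.singleton_inj.1 hΘ
    simpa using hL.hole k
  | leaf p m h => simp at hΘ
  | node p r s Θ₁ Θ₂ ψ₁ ψ₂ h h₁ h₂ ih₁ ih₂ =>
    have hval : S.value (Pi.single p 1 + (ψ₁ + ψ₂)) = S.value ψ₁ * S.value ψ₂ := by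
      simp [value_add, weight, h]
    rw [hval]
    -- The single open leaf lies in exactly one of the two subtrees.
    have hcases : Θ₁ = 0 ∧ Θ₂ = {i} ∨ Θ₁ = {i} ∧ Θ₂ = 0 := by
      have hcard := congrArg Multiset.card hΘ
      rw [Multiset.card_add, Multiset.card_singleton] at hcard
      rcases Nat.add_eq_one_iff.1 hcard with ⟨h0, -⟩ | ⟨-, h0⟩
      · obtain rfl := Multiset.card_eq_zero.1 h0
        exact Or.inl ⟨rfl, by simpa using hΘ⟩
      · obtain rfl := Multiset.card_eq_zero.1 h0
        exact Or.inr ⟨by simpa using hΘ, rfl⟩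
    rcases hcases with ⟨h1, h2⟩ | ⟨h1, h2⟩
    · exact hL.right p r s h _ _ _ _ _ (hclosed h₁ h1) (ih₂ h2)
    · exact hL.left p r s h _ _ _ _ _ (ih₁ h1) (hclosed h₂ h2)

end Lower

/-! ### Periods: minimal balanced counts -/

variable (S) in
/-- Nonzero balanced counts of productions in `U`. -/
def IsPeriod (U : Set ι) (ψ : ι → ℕ) : Prop :=
  ψ ≠ 0 ∧ S.IsBalanced ψ ∧ Function.support ψ ⊆ U

/-- Dickson's lemma: minimal elements form an antichain, and `ι → ℕ` is well quasi-ordered since `ι`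
is finite. -/
theorem finite_setOf_minimal (p : (ι → ℕ) → Prop) : {ψ | Minimal p ψ}.Finite :=
  WellQuasiOrderedLE.finite_of_isAntichain (setOfPred_minimal_antichain p)

variable (S) in
/-- The values of minimal nonzero balanced counts of productions in `U`. -/
noncomputable def periods [DecidableEq M] (U : Set ι) : Finset M :=
  (finite_setOf_minimal (S.IsPeriod U)).toFinset.image S.value

theorem mem_periods [DecidableEq M] {U : Set ι} {m : M} :
    m ∈ S.periods U ↔ ∃ ψ, Minimal (S.IsPeriod U) ψ ∧ S.value ψ = m := by
  simp [periods]

/-- Minimality survives the enlargement of `U` because a vector below `ψ` has its support inside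
that of `ψ`. -/
theorem periods_mono [DecidableEq M] {U V : Set ι} (h : U ⊆ V) : S.periods U ⊆ S.periods V := by
  intro m hm
  obtain ⟨ψ, hψ, rfl⟩ := mem_periods.1 hm
  refine mem_periods.2 ⟨ψ, ⟨⟨hψ.1.1, hψ.1.2.1, hψ.1.2.2.trans h⟩, fun φ hφ hle => ?_⟩, rfl⟩
  refine hψ.2 ⟨hφ.1, hφ.2.1, fun p hp => hψ.1.2.2 ?_⟩ hle
  exact fun h0 => hp (Nat.le_zero.1 (h0 ▸ hle p))

/-- A nonzero balanced vector lies above a period; subtracting it leaves a smaller balanced vector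
with support still in `U`. -/
theorem value_mem_closure_periods [DecidableEq M] {U : Set ι} (h : ι → ℕ)
    (hb : S.IsBalanced h) (hU : Function.support h ⊆ U) :
    S.value h ∈ Submonoid.closure (S.periods U : Set M) := by
  induction h using WellFoundedLT.induction with
  | ind h ih =>
    by_cases h0 : h = 0
    · subst h0
      simp
    obtain ⟨ψ, hle, hψ⟩ := exists_minimal_le_of_wellFoundedLT (S.IsPeriod U) h ⟨h0, hb, hU⟩
    obtain ⟨q, rfl⟩ := exists_add_of_le hle
    rw [value_add]
    refine mul_mem (Submonoid.subset_closure (mem_periods.2 ⟨ψ, hψ, rfl⟩)) (ih q ?_ ?_ ?_)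
    · refine lt_of_le_of_ne (by simp) fun h => hψ.1.1 ?_
      simpa using h
    · have := hb
      rw [IsBalanced, lhsCount_add, rhsCount_add, hψ.1.2.1] at this
      exact add_left_cancel this
    · exact fun p hp => hU (by simp_all)

/-- The periods which can be inserted at each nonterminal, for a tree that uses exactly the
productions in `U`. -/
theorem Tree.lower_periods [DecidableEq M] {Low : K → Option K → Finset M → M → Prop}
    (hL : IsLower S Low) {k : K} {ψ : ι → ℕ} (h : S.Tree k 0 ψ) :
    Low k none (S.periods (Function.support ψ)) (S.value ψ) := by
  classical
  have hex : ∀ m ∈ S.periods (Function.support ψ), ∃ p, ψ p ≠ 0 ∧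
      Low (S.lhs p) (some (S.lhs p)) ∅ m := by
    intro m hm
    obtain ⟨φ, hφ, rfl⟩ := mem_periods.1 hm
    obtain ⟨i, χ, hχ0, hle, ht⟩ := hφ.1.2.1.exists_tree hφ.1.1
    have hχ : S.IsPeriod (Function.support ψ) χ := by
      refine ⟨hχ0, add_right_cancel ht.lhsCount_add_eq, fun p hp => hφ.1.2.2 ?_⟩
      exact fun h0 => hp (Nat.le_zero.1 (h0 ▸ hle p))
    -- The loop found below the minimal vector `φ` is itself a period vector, so it has exactly the
    -- counts `φ`.
    obtain rfl := le_antisymm hle (hφ.2 hχ hle)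
    obtain ⟨p, hp, rfl⟩ := ht.exists_lhs_eq hχ0
    exact ⟨p, hφ.1.2.2 hp, ht.lower_of_context hL rfl⟩
  -- Each period is assigned to the nonterminals at which it is a certified loop. By `hex` at least
  -- one of them is expanded in the tree, so the union recovers all periods.
  let F : K → Finset M := fun k =>
    (S.periods (Function.support ψ)).filter fun m => Low k (some k) ∅ m
  convert h.lower_of_closed hL (F := F) (by simp [F]) rfl using 1
  ext m
  simp only [Finset.mem_biUnion, Finset.mem_filter, Finset.mem_univ, true_and, F]
  constructor
  · intro hm
    obtain ⟨p, hp, hl⟩ := hex m hm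
    exact ⟨p, hp, hm, hl⟩
  · rintro ⟨p, -, hm, -⟩
    exact hm

variable (S) in
/-- **Parikh's theorem**: the sets of values of the trees with given roots are described by a
finite table of linear sets. -/
theorem exists_table [DecidableEq M] {Low : K → Option K → Finset M → M → Prop}
    (hL : IsLower S Low) :
    ∃ T : Set (K × Finset M × M), T.Finite ∧ (∀ e ∈ T, Low e.1 none e.2.1 e.2.2) ∧
      (∀ p m, S.body p = Sum.inl m → ∃ e ∈ T, e.1 = S.lhs p ∧
        ∃ x ∈ Submonoid.closure (e.2.1 : Set M), m = e.2.2 * x) ∧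
      (∀ p i j, S.body p = Sum.inr (i, j) → ∀ e ∈ T, ∀ f ∈ T, e.1 = i → f.1 = j →
        ∃ g ∈ T, g.1 = S.lhs p ∧ e.2.1 ⊆ g.2.1 ∧ f.2.1 ⊆ g.2.1 ∧
          ∃ x ∈ Submonoid.closure (g.2.1 : Set M), e.2.2 * f.2.2 = g.2.2 * x) := by
  classical
  -- The support is fixed exactly: all of `U` must be used for the loops to be insertable, and the
  -- difference of two such vectors must stay inside `U`.
  let B : K → Set ι → Set (ι → ℕ) := fun k U =>
    {ψ | Minimal (fun ψ => S.Tree k 0 ψ ∧ Function.support ψ = U) ψ}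
  let T : Set (K × Finset M × M) := ⋃ p : ι, ⋃ U : Set ι,
    (fun ψ => (S.lhs p, S.periods U, S.value ψ)) '' B (S.lhs p) U
  have hT : ∀ e, e ∈ T ↔ ∃ p U ψ, ψ ∈ B (S.lhs p) U ∧
      (S.lhs p, S.periods U, S.value ψ) = e := by
    intro e
    simp only [T, Set.mem_iUnion, Set.mem_image]
  have hcover : ∀ p ψ, S.Tree (S.lhs p) 0 ψ → ∃ e ∈ T, e.1 = S.lhs p ∧
      e.2.1 = S.periods (Function.support ψ) ∧
        ∃ x ∈ Submonoid.closure (e.2.1 : Set M), S.value ψ = e.2.2 * x := by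
    intro p ψ hψ
    obtain ⟨φ, hle, hφ⟩ := exists_minimal_le_of_wellFoundedLT
      (fun φ => S.Tree (S.lhs p) 0 φ ∧ Function.support φ = Function.support ψ) ψ ⟨hψ, rfl⟩
    refine ⟨_, (hT _).2 ⟨p, _, φ, hφ, rfl⟩, rfl, rfl, ?_⟩
    obtain ⟨q, rfl⟩ := exists_add_of_le hle
    refine ⟨S.value q, value_mem_closure_periods _ ?_ ?_, value_add _ _⟩
    -- Both closed trees satisfy the count identity with the same root, hence their difference is
    -- balanced.
    · have h1 := hψ.lhsCount_add_eq
      have h2 := hφ.1.1.lhsCount_add_eq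
      rw [lhsCount_add, rhsCount_add, add_zero] at h1
      rw [add_zero] at h2
      rw [h2] at h1
      apply add_left_cancel (a := S.rhsCount φ + {S.lhs p})
      rw [h1]
      abel
    · exact fun p hp => by simp_all
  refine ⟨T, ?_, ?_, ?_, ?_⟩
  · exact Set.finite_iUnion fun p => Set.finite_iUnion fun U =>
      (finite_setOf_minimal _).image _
  · intro e he
    obtain ⟨p, U, ψ, hψ, rfl⟩ := (hT _).1 he
    obtain rfl := hψ.1.2
    exact hψ.1.1.lower_periods hL
  · intro p m h
    obtain ⟨e, he, h1, -, x, hx, h3⟩ := hcover p _ (Tree.leaf p m h)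
    refine ⟨e, he, h1, x, hx, ?_⟩
    rw [← h3]
    simp [weight, h]
  · intro p i j h e he f hf hi hj
    obtain ⟨r, U, ψ, hψ, rfl⟩ := (hT _).1 he
    obtain ⟨s, V, φ, hφ, rfl⟩ := (hT _).1 hf
    obtain rfl := hψ.1.2
    obtain rfl := hφ.1.2
    simp only at hi hj
    have ht := Tree.node p i j _ _ _ _ h (hi ▸ hψ.1.1) (hj ▸ hφ.1.1)
    rw [add_zero] at ht
    -- The composite tree need not be minimal, but an entry for its own support covers it. That
    -- support contains those of both subtrees, so monotonicity of periods gives the two inclusions.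
    obtain ⟨g, hg, h1, h2, x, hx, h3⟩ := hcover p _ ht
    refine ⟨g, hg, h1, ?_, ?_, x, hx, ?_⟩
    · rw [h2]
      exact periods_mono fun q hq => by simp_all
    · rw [h2]
      exact periods_mono fun q hq => by simp_all
    · rw [← h3]
      simp [value_add, weight, h]

end ProductionSystem

/-! ### Certificates for rational descriptions of context-free subsets -/

section Words

variable {G α : Type*} [Group G] (x : α → G)

@[simp] theorem wordEval_nil : wordEval x [] = 1 := rfl

@[simp] theorem wordEval_append (u v : SWord α) :
    wordEval x (u ++ v) = wordEval x u * wordEval x v := by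
  simp [wordEval]

theorem wordEval_cons (a : α × Bool) (u : SWord α) :
    wordEval x (a :: u) = wordEval x [a] * wordEval x u :=
  wordEval_append x [a] u

variable {x}

theorem wordEval_mem {A : Subgroup G} {l : List (SWord α)} (h : ∀ w ∈ l, wordEval x w ∈ A) :
    wordEval x l.flatten ∈ A := by
  induction l with
  | nil => exact A.one_mem
  | cons w l ih =>
    rw [List.flatten_cons, wordEval_append]
    exact A.mul_mem (h w (by simp)) (ih fun v hv => h v (by simp [hv]))

/-- Commutativity of `A` permits moving the factors from `P` in front of those from `Q`. -/
theorem wordEval_split {A : Subgroup G} (hA : ∀ a ∈ A, ∀ b ∈ A, a * b = b * a)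
    {P Q l : List (SWord α)} (hP : ∀ w ∈ P, wordEval x w ∈ A) (hQ : ∀ w ∈ Q, wordEval x w ∈ A)
    (hl : l ⊆ P ++ Q) :
    ∃ l₁ l₂, l₁ ⊆ P ∧ l₂ ⊆ Q ∧
      wordEval x l.flatten = wordEval x l₁.flatten * wordEval x l₂.flatten := by
  induction l with
  | nil => exact ⟨[], [], by simp, by simp, by simp⟩
  | cons w l ih =>
    rw [List.cons_subset] at hl
    obtain ⟨l₁, l₂, h1, h2, h3⟩ := ih hl.2
    rcases List.mem_append.1 hl.1 with hw | hw
    · refine ⟨w :: l₁, l₂, List.cons_subset.2 ⟨hw, h1⟩, h2, ?_⟩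
      simp [h3, mul_assoc]
    · refine ⟨l₁, w :: l₂, h1, List.cons_subset.2 ⟨hw, h2⟩, ?_⟩
      have hc := hA _ (wordEval_mem (x := x) (l := l₁) fun v hv => hP v (h1 hv)) _ (hQ w hw)
      simp only [List.flatten_cons, wordEval_append, h3]
      rw [← mul_assoc, ← hc, mul_assoc]

end Words

/-- Sentential forms over nonterminals `N` and terminals `(a, true)`, `(a, false)`. -/
abbrev SForm (N α : Type*) := List (N ⊕ (α × Bool))

section Yield

variable {G N α : Type*} [Group G]

/-- The values of the terminal words derived from a sentential form. -/
inductive Yield (rules : List (N × SForm N α)) (x : α → G) : SForm N α → G → Prop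
  | nil : Yield rules x [] 1
  | terminal (a : α × Bool) (β : SForm N α) (h : G) (hβ : Yield rules x β h) :
      Yield rules x (Sum.inr a :: β) (wordEval x [a] * h)
  | nonterminal (n : N) (κ β : SForm N α) (g h : G) (hn : (n, κ) ∈ rules)
      (hκ : Yield rules x κ g) (hβ : Yield rules x β h) : Yield rules x (Sum.inl n :: β) (g * h)

/-- Decompositions of the nonempty suffixes of a sentential form. -/
def formSplits : SForm N α → List (SForm N α × SForm N α × SForm N α)
  | [] => []
  | s :: β => (s :: β, [s], β) :: formSplits β

/-- Triples `(k, i, j)` such that products of values of `i` and `j` are values of `k`. -/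
def formTriples (rules : List (N × SForm N α)) :
    List (SForm N α × SForm N α × SForm N α) :=
  rules.flatMap fun r => ([Sum.inl r.1], r.2, []) :: formSplits r.2

theorem mem_formSplits {κ : SForm N α} {t : SForm N α × SForm N α × SForm N α} :
    t ∈ formSplits κ ↔ ∃ s β, s :: β <:+ κ ∧ t = (s :: β, [s], β) := by
  induction κ with
  | nil => simp [formSplits]
  | cons s κ ih =>
    simp only [formSplits, List.mem_cons, ih, List.suffix_cons_iff]
    constructor
    · rintro (rfl | ⟨s', β, h, rfl⟩)
      · exact ⟨s, κ, Or.inl rfl, rfl⟩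
      · exact ⟨s', β, Or.inr h, rfl⟩
    · rintro ⟨s', β, h | h, rfl⟩
      · cases h
        exact Or.inl rfl
      · exact Or.inr ⟨s', β, h, rfl⟩

theorem Yield.mul_of_mem {rules : List (N × SForm N α)} {x : α → G}
    {t : SForm N α × SForm N α × SForm N α} (ht : t ∈ formTriples rules) {g h : G}
    (hg : Yield rules x t.2.1 g) (hh : Yield rules x t.2.2 h) : Yield rules x t.1 (g * h) := by
  obtain ⟨r, hr, ht⟩ := List.mem_flatMap.1 ht
  rcases List.mem_cons.1 ht with rfl | ht
  · exact .nonterminal _ _ _ _ _ hr hg hh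
  · obtain ⟨s, β, -, rfl⟩ := mem_formSplits.1 ht
    simp only at hg hh
    cases hg with
    | terminal a _ g' hg' =>
      cases hg'
      rw [mul_one]
      exact .terminal _ _ _ hh
    | nonterminal n κ _ g' h' hn hκ hβ =>
      cases hβ
      rw [mul_one]
      exact .nonterminal _ _ _ _ _ hn hκ hh

end Yield

/-- A sentential form together with words for the cosets before and after it. -/
abbrev FormNode (N α : Type*) := SWord α × SForm N α × SWord α

/-- The entry `((σ, κ, σ'), P, a)` stands for the values `σ⁻¹ a m σ'` of `κ`, where `m` is a
product of elements of `P`. -/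
abbrev TableEntry (N α : Type*) := FormNode N α × List (SWord α) × SWord α

/-- The judgement `(k, none, P, a)` states that the entry `(k, P, a)` consists of values; the
judgement `(k, some i, P, a)` states the same up to multiplication with values of `i`. -/
abbrev Judgement (N α : Type*) :=
  FormNode N α × Option (FormNode N α) × List (SWord α) × SWord α

section Certificate

variable {G N α : Type*} [Group G] (eqv : SWord α → SWord α → Prop) (inA : SWord α → Prop)
  (rules : List (N × SForm N α))

/-- The rules for the derivation of judgements. -/
def LowerRule (prem : List (Judgement N α)) (j : Judgement N α) : Prop :=
  -- The alternatives are: the empty form, one letter, the bare open leaf, a product with the open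
  -- leaf in at most one factor, and pumping by a loop. They mirror `ProductionSystem.IsLower`, with
  -- inclusions of lists in place of unions of finite sets.
  (∃ σ, j.1 = (σ, [], σ) ∧ j.2.1 = none ∧ j.2.2.1 = [] ∧ eqv j.2.2.2 []) ∨
  (∃ a, j.1.2.1 = [Sum.inr a] ∧ j.2.1 = none ∧ j.2.2.1 = [] ∧ inA j.2.2.2 ∧
    eqv (j.1.1 ++ [a]) (j.2.2.2 ++ j.1.2.2)) ∨
  (j.2.1 = some j.1 ∧ j.2.2.1 = [] ∧ eqv j.2.2.2 []) ∨
  (∃ t σ c c' u u', t ∈ formTriples rules ∧ j.1.2.1 = t.1 ∧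
    ((j.1.1, t.2.1, σ), c, u) ∈ prem ∧ ((σ, t.2.2, j.1.2.2), c', u') ∈ prem ∧
    ((c = j.2.1 ∧ c' = none) ∨ (c = none ∧ c' = j.2.1)) ∧
    j.2.2.1 ⊆ u.1 ++ u'.1 ∧ eqv j.2.2.2 (u.2 ++ u'.2)) ∨
  (∃ p P, j.2.1 = none ∧ (j.1, none, P, j.2.2.2) ∈ prem ∧ (j.1, some j.1, [], p) ∈ prem ∧
    j.2.2.1 ⊆ p :: P)

/-- The value of `w` belongs to the linear set of the entry `e`. -/
def Covers (e : TableEntry N α) (w : SWord α) : Prop :=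
  ∃ l, l ⊆ e.2.1 ∧ eqv w (e.2.2 ++ (l.flatten ++ e.1.2.2))

/-- `T` is a table of linear sets for the values of the sentential forms of the grammar, with
coset representatives in `Q`. -/
structure IsCertificate (Q : List (SWord α)) (T : List (TableEntry N α)) : Prop where
  nil_mem : [] ∈ Q
  target_mem : ∀ e ∈ T, e.1.2.2 ∈ Q
  nil : ∀ σ ∈ Q, ∃ e, e ∈ T ∧ e.1 = (σ, [], σ) ∧ Covers eqv e σ
  -- The first alternative exempts nonterminals, so that the quantifier can run over the finite
  -- lists of symbols in the rules.
  terminal : ∀ σ ∈ Q, ∀ r ∈ rules, ∀ s ∈ r.2, (∃ n, s = Sum.inl n) ∨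
    ∃ a, s = Sum.inr a ∧ ∃ e, e ∈ T ∧ e.1.1 = σ ∧ e.1.2.1 = [Sum.inr a] ∧
      Covers eqv e (σ ++ [a])
  mul : ∀ t ∈ formTriples rules, ∀ e ∈ T, ∀ f ∈ T,
    (e.1.2.1 = t.2.1 ∧ f.1.2.1 = t.2.2 ∧ e.1.2.2 = f.1.1) → ∃ g, g ∈ T ∧
      g.1 = (e.1.1, t.1, f.1.2.2) ∧ e.2.1 ⊆ g.2.1 ∧ f.2.1 ⊆ g.2.1 ∧
      ∃ l, l ⊆ g.2.1 ∧ eqv (e.2.2 ++ f.2.2) (g.2.2 ++ l.flatten)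
  lower : ∀ e ∈ T, Derivable (LowerRule eqv inA rules) (e.1, none, e.2.1, e.2.2)

end Certificate

/-! ### Soundness: a certificate describes exactly the values -/

section Soundness

variable {G N α : Type*} [Group G] {x : α → G} {A : Subgroup G}
  (hA : ∀ a ∈ A, ∀ b ∈ A, a * b = b * a) {rules : List (N × SForm N α)}

/-- The values of a node, relative to its coset representatives. -/
def NodeYield (rules : List (N × SForm N α)) (x : α → G) (k : FormNode N α) (g : G) : Prop :=
  Yield rules x k.2.1 ((wordEval x k.1)⁻¹ * g * wordEval x k.2.2)

/-- The values which may be inserted into the open leaf of a judgement. -/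
def LeafYield (rules : List (N × SForm N α)) (x : α → G) (c : Option (FormNode N α)) (g : G) :
    Prop :=
  (c = none → g = 1) ∧ ∀ k, c = some k → NodeYield rules x k g

include hA in
-- Induction on the derivation. The invariant includes that all words involved evaluate into `A`;
-- this is what allows factors to be reordered, and the value `z` of the open leaf to be moved to
-- the end.
theorem judgement_sound {j : Judgement N α}
    (hj : Derivable (LowerRule (fun u v => wordEval x u = wordEval x v)
      (fun w => wordEval x w ∈ A) rules) j) :
    wordEval x j.2.2.2 ∈ A ∧ (∀ p ∈ j.2.2.1, wordEval x p ∈ A) ∧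
      ∀ l ⊆ j.2.2.1, ∀ z ∈ A, LeafYield rules x j.2.1 z →
        NodeYield rules x j.1 (wordEval x j.2.2.2 * wordEval x l.flatten * z) := by
  induction hj with
  | intro prem j _ h ih =>
  obtain ⟨⟨s, κ, s'⟩, c, P, a⟩ := j
  simp only [LowerRule] at h
  rcases h with ⟨σ, h1, rfl, rfl, h2⟩ | ⟨b, rfl, rfl, rfl, h1, h2⟩ | ⟨rfl, rfl, h1⟩ |
    ⟨t, σ, c₁, c₂, u, v, ht, rfl, hu, hv, hc, hP, ha⟩ | ⟨p, P', rfl, h1, h2, h3⟩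
  · cases h1
    simp only [h2]
    refine ⟨A.one_mem, by simp, fun l hl z hz hz' => ?_⟩
    obtain rfl := List.subset_nil.1 hl
    obtain rfl := hz'.1 rfl
    simpa [NodeYield] using Yield.nil
  · refine ⟨h1, by simp, fun l hl z hz hz' => ?_⟩
    obtain rfl := List.subset_nil.1 hl
    obtain rfl := hz'.1 rfl
    have := Yield.terminal (rules := rules) (x := x) b _ _ .nil
    rw [mul_one] at this
    simp only [wordEval_append] at h2
    simpa [NodeYield, mul_assoc, ← h2] using this
  · simp only [h1]
    refine ⟨A.one_mem, by simp, fun l hl z hz hz' => ?_⟩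
    obtain rfl := List.subset_nil.1 hl
    simpa using hz'.2 _ rfl
  · obtain ⟨u1, u2, u3⟩ := ih _ hu
    obtain ⟨v1, v2, v3⟩ := ih _ hv
    simp only [wordEval_append] at ha u1 u2 u3 v1 v2 v3 ⊢
    refine ⟨ha ▸ A.mul_mem u1 v1, fun p hp => ?_, fun l hl z hz hz' => ?_⟩
    · rcases List.mem_append.1 (hP hp) with hp | hp
      · exact u2 p hp
      · exact v2 p hp
    -- The factors are distributed over the two premises; `z` goes to the one with the open leaf and
    -- `1` to the other. The middle coset word `σ` cancels.
    · obtain ⟨l₁, l₂, hl₁, hl₂, hl⟩ := wordEval_split hA u2 v2 (List.Subset.trans hl hP)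
      have m1 : wordEval x l₁.flatten ∈ A := wordEval_mem fun w hw => u2 w (hl₁ hw)
      have m2 : wordEval x l₂.flatten ∈ A := wordEval_mem fun w hw => v2 w (hl₂ hw)
      have h1 : LeafYield rules x none 1 := ⟨fun _ => rfl, by simp⟩
      rw [hl, ha]
      rcases hc with ⟨rfl, rfl⟩ | ⟨rfl, rfl⟩
      · have := Yield.mul_of_mem ht (u3 l₁ hl₁ z hz hz') (v3 l₂ hl₂ 1 A.one_mem h1)
        unfold NodeYield
        convert this using 1
        have c1 := hA _ v1 _ m1
        simp only
        have c2 := hA _ (A.mul_mem v1 m2) _ hz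
        calc _ = (wordEval x s)⁻¹ * (wordEval x u.2 * (wordEval x v.2 * wordEval x l₁.flatten) *
              wordEval x l₂.flatten * z) * wordEval x s' := by group
          _ = (wordEval x s)⁻¹ * (wordEval x u.2 * wordEval x l₁.flatten * ((wordEval x v.2 *
              wordEval x l₂.flatten) * z)) * wordEval x s' := by rw [c1]; group
          _ = _ := by rw [c2]; group
      · have := Yield.mul_of_mem ht (u3 l₁ hl₁ 1 A.one_mem h1) (v3 l₂ hl₂ z hz hz')
        unfold NodeYield
        convert this using 1
        have c1 := hA _ v1 _ m1
        simp only
        calc _ = (wordEval x s)⁻¹ * (wordEval x u.2 * (wordEval x v.2 * wordEval x l₁.flatten) *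
              wordEval x l₂.flatten * z) * wordEval x s' := by group
          _ = _ := by rw [c1]; group
  · obtain ⟨u1, u2, u3⟩ := ih _ h1
    obtain ⟨v1, v2, v3⟩ := ih _ h2
    simp only at u1 u2 u3 v1 v2 v3 ⊢
    have hPA : ∀ q ∈ p :: P', wordEval x q ∈ A := by
      intro q hq
      rcases List.mem_cons.1 hq with rfl | hq
      · exact v1
      · exact u2 q hq
    refine ⟨u1, fun q hq => hPA q (h3 hq), fun l hl z hz hz' => ?_⟩
    obtain rfl := hz'.1 rfl
    -- Processes `l` factor by factor: a factor `p` wraps the loop around the remaining value, and a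
    -- factor from `P'` is collected in `l'` for the final use of the first premise.
    have key : ∀ l l' : List (SWord α), l ⊆ p :: P' → l' ⊆ P' → NodeYield rules x (s, κ, s')
        (wordEval x a * wordEval x l'.flatten * wordEval x l.flatten) := by
      intro l
      induction l with
      | nil =>
        intro l' _ hl'
        simpa using u3 l' hl' 1 A.one_mem ⟨fun _ => rfl, by simp⟩
      | cons q l ih =>
        intro l' hl hl'
        rw [List.cons_subset] at hl
        have ml : wordEval x l.flatten ∈ A := wordEval_mem fun w hw => hPA w (hl.2 hw)
        have ml' : wordEval x l'.flatten ∈ A := wordEval_mem fun w hw => u2 w (hl' hw)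
        rcases List.mem_cons.1 hl.1 with rfl | hq
        · have m := A.mul_mem (A.mul_mem u1 ml') ml
          have := v3 [] (by simp) _ m ⟨by simp, by
            rintro k hk
            cases hk
            exact ih l' hl.2 hl'⟩
          convert this using 1
          have c1 := hA _ v1 _ (A.mul_mem u1 ml')
          simp only [List.flatten_cons, wordEval_append, List.flatten_nil, wordEval_nil, mul_one]
          rw [← mul_assoc, ← c1]
          group
        · have := ih (l' ++ [q]) hl.2 (by
            intro w hw
            rcases List.mem_append.1 hw with hw | hw
            · exact hl' hw
            · rw [List.mem_singleton.1 hw]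
              exact hq)
          convert this using 1
          simp [mul_assoc]
    simpa using key l [] (List.Subset.trans hl h3) (by simp)

/-- Every value of `κ` belongs to a linear set of the table, for each coset at the start. -/
def IsUpper (x : α → G) (Q : List (SWord α)) (T : List (TableEntry N α)) (κ : SForm N α)
    (g : G) : Prop :=
  ∀ σ ∈ Q, ∃ e ∈ T, e.1.1 = σ ∧ e.1.2.1 = κ ∧ ∃ l ⊆ e.2.1,
    wordEval x σ * g = wordEval x e.2.2 * wordEval x l.flatten * wordEval x e.1.2.2

variable {Q : List (SWord α)} {T : List (TableEntry N α)}
  (hC : IsCertificate (fun u v => wordEval x u = wordEval x v) (fun w => wordEval x w ∈ A)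
    rules Q T)

include hA hC

/-- The entry found for `g` ends in a coset word of `Q`, from which `h` can be read. Commutativity
gathers both constants in front, and closure of the table absorbs their product. -/
theorem IsUpper.mul {t : SForm N α × SForm N α × SForm N α} (ht : t ∈ formTriples rules)
    {g h : G} (hg : IsUpper x Q T t.2.1 g) (hh : IsUpper x Q T t.2.2 h) :
    IsUpper x Q T t.1 (g * h) := by
  intro σ hσ
  obtain ⟨e, he, rfl, he2, l, hl, hel⟩ := hg σ hσ
  obtain ⟨f, hf, hf1, hf2, l', hl', hfl⟩ := hh _ (hC.target_mem e he)
  obtain ⟨k, hk, hk1, hek, hfk, l'', hl'', hkl⟩ := hC.mul t ht e he f hf ⟨he2, hf2, hf1.symm⟩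
  obtain ⟨-, me, -⟩ := judgement_sound hA (hC.lower e he)
  obtain ⟨mf, mf', -⟩ := judgement_sound hA (hC.lower f hf)
  have ml : wordEval x l.flatten ∈ A := wordEval_mem fun w hw => me w (hl hw)
  refine ⟨k, hk, by rw [hk1], by rw [hk1], l'' ++ (l ++ l'), ?_, ?_⟩
  · exact List.append_subset.2 ⟨hl'', List.append_subset.2
      ⟨List.Subset.trans hl hek, List.Subset.trans hl' hfk⟩⟩
  · have c1 := hA _ mf _ ml
    simp only [wordEval_append] at hkl
    rw [hk1]
    simp only [List.flatten_append, wordEval_append]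
    calc _ = wordEval x e.2.2 * wordEval x l.flatten * (wordEval x e.1.2.2 * h) := by
          rw [← mul_assoc, hel]; group
      _ = wordEval x e.2.2 * (wordEval x l.flatten * wordEval x f.2.2) *
          wordEval x l'.flatten * wordEval x f.1.2.2 := by rw [hfl]; group
      _ = (wordEval x e.2.2 * wordEval x f.2.2) * (wordEval x l.flatten *
          wordEval x l'.flatten) * wordEval x f.1.2.2 := by rw [← c1]; group
      _ = _ := by rw [hkl]; group

omit hA in
theorem isUpper_nil : IsUpper x Q T [] 1 := by
  intro σ hσ
  obtain ⟨e, he, he1, l, hl, hel⟩ := hC.nil σ hσ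
  refine ⟨e, he, by rw [he1], by rw [he1], l, hl, ?_⟩
  simpa [mul_assoc] using hel

/-- The induction is confined to suffixes of right-hand sides, since `formTriples` decomposes only
these. A leading nonterminal takes two steps: rewriting it, then multiplying by the rest. -/
theorem isUpper_of_suffix {κ : SForm N α} {g : G} (h : Yield rules x κ g) :
    (∃ r ∈ rules, κ <:+ r.2) → IsUpper x Q T κ g := by
  induction h with
  | nil => exact fun _ => isUpper_nil hC
  | terminal a β h hβ ih =>
    rintro ⟨r, hr, hs⟩
    have ht : (Sum.inr a :: β, [Sum.inr a], β) ∈ formTriples rules :=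
      List.mem_flatMap.2 ⟨r, hr, List.mem_cons_of_mem _ (mem_formSplits.2 ⟨_, _, hs, rfl⟩)⟩
    refine IsUpper.mul hA hC ht ?_ (ih ⟨r, hr, (List.suffix_cons _ _).trans hs⟩)
    intro σ hσ
    rcases hC.terminal σ hσ r hr (Sum.inr a) (hs.subset (by simp)) with
      ⟨n, hn⟩ | ⟨b, hb, e, he, rfl, he2, l, hl, hel⟩
    · cases hn
    · cases hb
      refine ⟨e, he, rfl, he2, l, hl, ?_⟩
      simpa [mul_assoc] using hel
  | nonterminal n κ β g h hn hκ hβ ihκ ihβ =>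
    rintro ⟨r, hr, hs⟩
    have ht : (Sum.inl n :: β, [Sum.inl n], β) ∈ formTriples rules :=
      List.mem_flatMap.2 ⟨r, hr, List.mem_cons_of_mem _ (mem_formSplits.2 ⟨_, _, hs, rfl⟩)⟩
    have ht' : ([Sum.inl n], κ, []) ∈ formTriples rules :=
      List.mem_flatMap.2 ⟨_, hn, List.mem_cons_self⟩
    refine IsUpper.mul hA hC ht ?_ (ihβ ⟨r, hr, (List.suffix_cons _ _).trans hs⟩)
    have := IsUpper.mul hA hC ht' (ihκ ⟨_, hn, List.suffix_rfl⟩) (isUpper_nil hC)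
    rwa [mul_one] at this

/-- The start symbol need not be a suffix of a right-hand side, so its first rewriting step is
treated separately. -/
theorem isUpper_start {n : N} {g : G} (h : Yield rules x [Sum.inl n] g) :
    IsUpper x Q T [Sum.inl n] g := by
  cases h with
  | nonterminal n κ β g h hn hκ hβ =>
    cases hβ
    have ht' : ([Sum.inl n], κ, []) ∈ formTriples rules :=
      List.mem_flatMap.2 ⟨_, hn, List.mem_cons_self⟩
    exact IsUpper.mul hA hC ht' (isUpper_of_suffix hA hC hκ ⟨_, hn, List.suffix_rfl⟩)
      (isUpper_nil hC)

theorem yield_iff_of_isCertificate (n : N) (g : G) :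
    Yield rules x [Sum.inl n] g ↔ ∃ e ∈ T, e.1.1 = [] ∧ e.1.2.1 = [Sum.inl n] ∧
      ∃ l ⊆ e.2.1, g = wordEval x e.2.2 * wordEval x l.flatten * wordEval x e.1.2.2 := by
  constructor
  · intro h
    obtain ⟨e, he, h1, h2, l, hl, h3⟩ := isUpper_start hA hC h [] hC.nil_mem
    exact ⟨e, he, h1, h2, l, hl, by simpa using h3⟩
  · rintro ⟨e, he, h1, h2, l, hl, rfl⟩
    obtain ⟨-, -, h⟩ := judgement_sound hA (hC.lower e he)
    have := h l hl 1 A.one_mem ⟨fun _ => rfl, by simp⟩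
    simpa [NodeYield, h1, h2, mul_assoc] using this

end Soundness

/-! ### Completeness: Parikh's theorem yields a certificate -/

section Completeness

variable {G N α : Type*} [Group G]

/-- Words for representatives of the right cosets of a subgroup of finite index. -/
theorem exists_coset_word {x : α → G} (A : Subgroup G) [A.FiniteIndex] {ok : SWord α → Prop}
    (hnil : ok []) (hok : ∀ g, ∃ w, ok w ∧ wordEval x w = g) :
    ∃ st : G → SWord α, (Set.range st).Finite ∧ st 1 = [] ∧ (∀ g, ok (st g)) ∧
      ∀ g, g * (wordEval x (st g))⁻¹ ∈ A := by
  classical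
  -- `G ⧸ A` consists of left cosets, so the right coset of `g` is represented through `g⁻¹`. The
  -- coset of `1` receives the empty word, where reading starts.
  choose word hw hword using hok
  let s : G ⧸ A → SWord α := fun c => if c = (1 : G) then [] else word (Quotient.out c)⁻¹
  refine ⟨fun g => s (g⁻¹ : G), ?_, by simp [s], fun g => ?_, fun g => ?_⟩
  · exact (Set.finite_range s).subset (by rintro _ ⟨g, rfl⟩; exact ⟨_, rfl⟩)
  · simp only [s]
    split_ifs
    · exact hnil
    · exact hw _
  · simp only [s]
    split_ifs with h
    · have := QuotientGroup.eq.1 h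
      simpa using this
    · rw [hword, inv_inv]
      have h1 : ((Quotient.out ((g⁻¹ : G) : G ⧸ A) : G) : G ⧸ A) = ((g⁻¹ : G) : G ⧸ A) :=
        Quotient.out_eq _
      simpa using QuotientGroup.eq.1 h1.symm

theorem wordEval_map_flatten {x : α → G} {A : Subgroup G} {word : A → SWord α}
    (hword : ∀ a, wordEval x (word a) = a) (l : List A) :
    wordEval x (l.map word).flatten = (l.prod : A) := by
  induction l with
  | nil => simp
  | cons a l ih =>
    rw [List.map_cons, List.flatten_cons, wordEval_append, ih, hword, List.prod_cons]
    rfl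

/-- Parikh's theorem is applied to the production system on nodes `(σ, κ, σ')` with values in the
commutative group `A`, taking derivability of judgements as the lower predicate. The predicate `ok`
keeps all chosen words over the permitted letters. -/
theorem exists_certificate {x : α → G} {A : Subgroup G} [A.FiniteIndex]
    (hA : ∀ a ∈ A, ∀ b ∈ A, a * b = b * a) {ok : SWord α → Prop}
    (hnil : ok []) (hok : ∀ g, ∃ w, ok w ∧ wordEval x w = g) (rules : List (N × SForm N α)) :
    ∃ Q T, IsCertificate (fun u v => wordEval x u = wordEval x v) (fun w => wordEval x w ∈ A)
      rules Q T ∧ ∀ e ∈ T, ok e.2.2 ∧ ok e.1.2.2 ∧ ∀ p ∈ e.2.1, ok p := by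
  classical
  obtain ⟨st, hfin, hst1, hstok, hst⟩ := exists_coset_word A hnil hok
  have hok' : ∀ a : A, ∃ w, ok w ∧ wordEval x w = a := fun a => hok a
  choose word hw hword using hok'
  let _ : CommGroup A := { (inferInstance : Group A) with
    mul_comm := fun a b => Subtype.ext (hA a a.2 b b.2) }
  let nilProd : SWord α → FormNode N α × (A ⊕ FormNode N α × FormNode N α) :=
    fun σ => ((σ, [], σ), Sum.inl 1)
  -- The representative of the coset reached from `σ` by reading the letter `a`.
  let next : SWord α → α × Bool → SWord α := fun σ a => st (wordEval x (σ ++ [a]))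
  let letterProd : SWord α × (α × Bool) → FormNode N α × (A ⊕ FormNode N α × FormNode N α) :=
    fun y => ((y.1, [Sum.inr y.2], next y.1 y.2),
      Sum.inl ⟨wordEval x (y.1 ++ [y.2]) * (wordEval x (next y.1 y.2))⁻¹, hst _⟩)
  let mulProd : (SForm N α × SForm N α × SForm N α) × SWord α × SWord α × SWord α →
      FormNode N α × (A ⊕ FormNode N α × FormNode N α) :=
    fun y => ((y.2.1, y.1.1, y.2.2.2),
      Sum.inr ((y.2.1, y.1.2.1, y.2.2.1), (y.2.2.1, y.1.2.2, y.2.2.2)))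
  let letters : Set (α × Bool) := {a | Sum.inr a ∈ rules.flatMap fun r => r.2}
  have hletters : letters.Finite :=
    Set.Finite.preimage (f := fun a : α × Bool => (Sum.inr a : N ⊕ (α × Bool)))
      (Sum.inr_injective.injOn) (List.finite_toSet (rules.flatMap fun r : N × SForm N α => r.2))
  let R : Set (SWord α) := Set.range st
  -- Finite because there are finitely many coset words, letters and triples.
  let Pr : Set (FormNode N α × (A ⊕ FormNode N α × FormNode N α)) :=
    nilProd '' R ∪ letterProd '' (R ×ˢ letters) ∪
      mulProd '' ({t | t ∈ formTriples rules} ×ˢ R ×ˢ R ×ˢ R)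
  have hPr : Pr.Finite :=
    ((hfin.image _).union ((hfin.prod hletters).image _)).union
      (((List.finite_toSet _).prod (hfin.prod (hfin.prod hfin))).image _)
  have : Fintype Pr := hPr.fintype
  let S : ProductionSystem Pr (FormNode N α) A := ⟨fun p => p.1.1, fun p => p.1.2⟩
  let eqv : SWord α → SWord α → Prop := fun u v => wordEval x u = wordEval x v
  let inA : SWord α → Prop := fun w => wordEval x w ∈ A
  -- Quantifying over all lists `P'` of words for elements of `P` makes order and repetition in the
  -- list irrelevant.
  let Low : FormNode N α → Option (FormNode N α) → Finset A → A → Prop := fun k c P a =>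
    ∀ P' : List (SWord α), (∀ p ∈ P', ∃ m ∈ P, p = word m) →
      Derivable (LowerRule eqv inA rules) (k, c, P', word a)
  have hempty : ∀ P' : List (SWord α), (∀ p ∈ P', ∃ m ∈ (∅ : Finset A), p = word m) → P' = [] :=
    fun P' h => List.eq_nil_iff_forall_not_mem.2 fun p hp => by simpa using h p hp
  have hlist : ∀ P : Finset A, ∀ p ∈ P.toList.map word, ∃ m ∈ P, p = word m := by
    intro P p hp
    obtain ⟨m, hm, rfl⟩ := List.mem_map.1 hp
    exact ⟨m, Finset.mem_toList.1 hm, rfl⟩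
  have hmul : ∀ p : Pr, ∀ i j, S.body p = Sum.inr (i, j) → ∃ t σ, t ∈ formTriples rules ∧
      (S.lhs p).2.1 = t.1 ∧ i = ((S.lhs p).1, t.2.1, σ) ∧ j = (σ, t.2.2, (S.lhs p).2.2) := by
    intro p i j h
    obtain ⟨p, hp⟩ := p
    replace h : p.2 = Sum.inr (i, j) := h
    rcases hp with (⟨σ, -, rfl⟩ | ⟨y, -, rfl⟩) | ⟨y, hy, rfl⟩
    · cases h
    · cases h
    · cases h
      exact ⟨y.1, y.2.2.1, hy.1, rfl, rfl, rfl⟩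
  have hL : S.IsLower Low := by
    refine ⟨?_, ?_, ?_, ?_, ?_⟩
    · intro p m h P' hP'
      obtain ⟨p, hp⟩ := p
      replace h : p.2 = Sum.inl m := h
      rcases hp with (⟨σ, -, rfl⟩ | ⟨y, -, rfl⟩) | ⟨y, -, rfl⟩
      · cases h
        refine ⟨[], _, by simp, Or.inl ⟨σ, rfl, rfl, hempty _ hP', ?_⟩⟩
        simp [eqv, hword]
      · cases h
        refine ⟨[], _, by simp, Or.inr (Or.inl ⟨y.2, rfl, rfl, hempty _ hP', ?_, ?_⟩)⟩
        · simp only [inA, hword]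
          exact hst _
        · simp [eqv, hword, S, letterProd]
      · cases h
    · intro k P' hP'
      refine ⟨[], _, by simp, Or.inr (Or.inr (Or.inl ⟨rfl, hempty _ hP', ?_⟩))⟩
      simp [eqv, hword]
    · intro p i j h c P a Q b h1 h2 P' hP'
      obtain ⟨t, σ, ht, hk, rfl, rfl⟩ := hmul p i j h
      refine ⟨[_, _], _, ?_, Or.inr (Or.inr (Or.inr (Or.inl ⟨t, σ, c, none,
        (P.toList.map word, word a), (Q.toList.map word, word b),
        ht, hk, List.mem_cons_self, List.mem_cons_of_mem _ List.mem_cons_self, Or.inl ⟨rfl, rfl⟩,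
        ?_, ?_⟩)))⟩
      · simpa using ⟨h1 _ (hlist P), h2 _ (hlist Q)⟩
      · intro p hp
        obtain ⟨m, hm, rfl⟩ := hP' p hp
        simp only [List.mem_append, List.mem_map, Finset.mem_toList]
        exact (Finset.mem_union.1 hm).imp (fun h => ⟨m, h, rfl⟩) fun h => ⟨m, h, rfl⟩
      · simp [eqv, hword]
    · intro p i j h c P a Q b h1 h2 P' hP'
      obtain ⟨t, σ, ht, hk, rfl, rfl⟩ := hmul p i j h
      refine ⟨[_, _], _, ?_, Or.inr (Or.inr (Or.inr (Or.inl ⟨t, σ, none, c,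
        (P.toList.map word, word a), (Q.toList.map word, word b),
        ht, hk, List.mem_cons_self, List.mem_cons_of_mem _ List.mem_cons_self, Or.inr ⟨rfl, rfl⟩,
        ?_, ?_⟩)))⟩
      · simpa using ⟨h1 _ (hlist P), h2 _ (hlist Q)⟩
      · intro p hp
        obtain ⟨m, hm, rfl⟩ := hP' p hp
        simp only [List.mem_append, List.mem_map, Finset.mem_toList]
        exact (Finset.mem_union.1 hm).imp (fun h => ⟨m, h, rfl⟩) fun h => ⟨m, h, rfl⟩
      · simp [eqv, hword]
    · intro k P a m h1 h2 P' hP'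
      refine ⟨[_, _], _, ?_, Or.inr (Or.inr (Or.inr (Or.inr ⟨word m,
        P.toList.map word, rfl, List.mem_cons_self,
        List.mem_cons_of_mem _ List.mem_cons_self, ?_⟩)))⟩
      · simpa using ⟨h1 _ (hlist P), h2 [] (by simp)⟩
      · intro p hp
        obtain ⟨m', hm, rfl⟩ := hP' p hp
        simp only [List.mem_cons, List.mem_map, Finset.mem_toList]
        rcases Finset.mem_insert.1 hm with rfl | h
        · exact Or.inl rfl
        · exact Or.inr ⟨m', h, rfl⟩
  obtain ⟨T, hT, hlow, hleaf, hnode⟩ := S.exists_table hL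
  let enc : FormNode N α × Finset A × A → TableEntry N α := fun e =>
    (e.1, e.2.1.toList.map word, word e.2.2)
  -- Only entries between chosen coset words are kept, so that `target_mem` holds.
  have hT' : (enc '' {e | e ∈ T ∧ e.1.1 ∈ R ∧ e.1.2.2 ∈ R}).Finite :=
    (hT.subset fun _ he => he.1).image _
  have hmemT : ∀ e, e ∈ hT'.toFinset.toList ↔
      ∃ e', (e' ∈ T ∧ e'.1.1 ∈ R ∧ e'.1.2.2 ∈ R) ∧ enc e' = e := by
    intro e
    rw [Finset.mem_toList, Set.Finite.mem_toFinset]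
    rfl
  have hmemQ : ∀ σ, σ ∈ hfin.toFinset.toList ↔ σ ∈ R := by simp [R]
  have hsub : ∀ P : Finset A, ∀ m ∈ Submonoid.closure (P : Set A), ∃ l,
      l ⊆ P.toList.map word ∧ wordEval x l.flatten = (m : G) := by
    intro P m hm
    obtain ⟨l, hl, rfl⟩ := Submonoid.exists_list_of_mem_closure hm
    refine ⟨l.map word, ?_, wordEval_map_flatten hword l⟩
    exact List.map_subset _ fun a ha => Finset.mem_toList.2 (hl a ha)
  refine ⟨hfin.toFinset.toList, hT'.toFinset.toList, ⟨?_, ?_, ?_, ?_, ?_, ?_⟩, ?_⟩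
  · exact (hmemQ _).2 ⟨1, hst1⟩
  · intro e he
    obtain ⟨e, hT, rfl⟩ := (hmemT _).1 he
    exact (hmemQ _).2 hT.2.2
  · intro σ hσ
    rw [hmemQ] at hσ
    obtain ⟨e, he, h1, y, hy, h2⟩ :=
      hleaf ⟨nilProd σ, Or.inl (Or.inl ⟨σ, hσ, rfl⟩)⟩ 1 rfl
    obtain ⟨l, hl, hly⟩ := hsub _ _ hy
    refine ⟨enc e, (hmemT _).2 ⟨e, ⟨he, by rw [h1]; exact ⟨hσ, hσ⟩⟩, rfl⟩, h1, l, hl, ?_⟩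
    have h2' : (1 : G) = e.2.2 * y := congrArg Subtype.val h2
    simp only [enc, wordEval_append, hword, hly, h1]
    rw [← mul_assoc, ← h2', one_mul]
  · intro σ hσ r hr s hs
    rw [hmemQ] at hσ
    rcases s with n | a
    · exact Or.inl ⟨n, rfl⟩
    refine Or.inr ⟨a, rfl, ?_⟩
    have ha : a ∈ letters := List.mem_flatMap.2 ⟨r, hr, hs⟩
    obtain ⟨e, he, h1, y, hy, h2⟩ :=
      hleaf ⟨letterProd (σ, a), Or.inl (Or.inr ⟨(σ, a), ⟨hσ, ha⟩, rfl⟩)⟩ _ rfl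
    obtain ⟨l, hl, hly⟩ := hsub _ _ hy
    have h3 : e.1 = (σ, [Sum.inr a], next σ a) := h1
    refine ⟨enc e, (hmemT _).2 ⟨e, ⟨he, ?_⟩, rfl⟩, ?_, ?_, l, hl, ?_⟩
    · rw [h3]
      exact ⟨hσ, _, rfl⟩
    · simp [enc, h3]
    · simp [enc, h3]
    have h2' : wordEval x (σ ++ [a]) * (wordEval x (next σ a))⁻¹ = e.2.2 * y :=
      congrArg Subtype.val h2
    simp only [enc, wordEval_append x (word _), wordEval_append x l.flatten, hword, hly, h3]
    rw [← mul_assoc, ← h2']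
    group
  · rintro t ht _ heT _ hfT ⟨h1, h2, h3⟩
    obtain ⟨e, ⟨he, hes, he'⟩, rfl⟩ := (hmemT _).1 heT
    obtain ⟨f, ⟨hf, -, hf'⟩, rfl⟩ := (hmemT _).1 hfT
    obtain ⟨⟨s, i, s'⟩, P, a⟩ := e
    obtain ⟨⟨s₁, j, s''⟩, P', b⟩ := f
    simp only [enc] at h1 h2 h3
    subst h1 h2 h3
    obtain ⟨g, hg, h4, h5, h6, y, hy, h7⟩ := hnode
      ⟨mulProd (t, s, s', s''), Or.inr ⟨(t, s, s', s''), ⟨ht, hes, he', hf'⟩, rfl⟩⟩ _ _ rfl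
      ((s, t.2.1, s'), P, a) he ((s', t.2.2, s''), P', b) hf rfl rfl
    obtain ⟨l, hl, hly⟩ := hsub _ _ hy
    refine ⟨enc g, (hmemT _).2 ⟨g, ⟨hg, by rw [h4]; exact ⟨hes, hf'⟩⟩, rfl⟩, h4, ?_, ?_, l, hl, ?_⟩
    · exact List.map_subset _ fun m hm => by simpa using h5 (by simpa using hm)
    · exact List.map_subset _ fun m hm => by simpa using h6 (by simpa using hm)
    · have h7' : (a : G) * b = g.2.2 * y := congrArg Subtype.val h7
      simpa [enc, hword, hly] using h7'
  · intro e he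
    obtain ⟨e, hT, rfl⟩ := (hmemT _).1 he
    exact hlow e hT.1 _ (hlist _)
  · intro e he
    obtain ⟨e, ⟨-, -, g, hg⟩, rfl⟩ := (hmemT _).1 he
    refine ⟨hw _, hg ▸ hstok g, fun p hp => ?_⟩
    obtain ⟨m, -, rfl⟩ := hlist _ p hp
    exact hw _

end Completeness

/-! ### Regular expressions of tables, and regularity of their languages -/

section Expr

variable {β : Type*}

/-- The regular expression of a word. -/
def wordExpr (w : List β) : RegularExpression β :=
  w.foldr (fun c E => .comp (.char c) E) .epsilon

/-- The regular expression `p₁* ⋯ pₖ*`. -/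
def starsExpr (P : List (List β)) : RegularExpression β :=
  P.foldr (fun p E => .comp (.star (wordExpr p)) E) .epsilon

/-- The regular expression of an entry of a table. -/
def entryExpr {N α : Type*} (e : TableEntry N α) : RegularExpression (α × Bool) :=
  .comp (wordExpr e.2.2) (.comp (starsExpr e.2.1) (wordExpr e.1.2.2))

open Classical in
/-- The regular expression for the values of a nonterminal. -/
noncomputable def tableExpr {N α : Type*} (n : N) (T : List (TableEntry N α)) :
    RegularExpression (α × Bool) :=
  (T.filter fun e => e.1.1 = [] ∧ e.1.2.1 = [Sum.inl n]).foldr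
    (fun e E => .plus (entryExpr e) E) .zero

theorem mem_wordExpr {w v : List β} : v ∈ (wordExpr w).matches' ↔ v = w := by
  induction w generalizing v with
  | nil => exact Set.mem_singleton_iff
  | cons c w ih =>
    change v ∈ ({[c]} : Language β) * (wordExpr w).matches' ↔ _
    rw [Language.mem_mul]
    constructor
    · rintro ⟨a, ha, b, hb, rfl⟩
      rw [Set.mem_singleton_iff.1 ha, ih.1 hb]
      rfl
    · rintro rfl
      exact ⟨[c], rfl, w, ih.2 rfl, rfl⟩

theorem mem_starsExpr_cons {p v : List β} {P : List (List β)} :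
    v ∈ (starsExpr (p :: P)).matches' ↔ ∃ l : List (List β), (∀ q ∈ l, q = p) ∧
      ∃ w ∈ (starsExpr P).matches', v = l.flatten ++ w := by
  change v ∈ KStar.kstar (wordExpr p).matches' * (starsExpr P).matches' ↔ _
  rw [Language.mem_mul]
  constructor
  · rintro ⟨a, ha, b, hb, rfl⟩
    obtain ⟨l, rfl, hl⟩ := Language.mem_kstar.1 ha
    exact ⟨l, fun q hq => mem_wordExpr.1 (hl q hq), b, hb, rfl⟩
  · rintro ⟨l, hl, w, hw, rfl⟩
    exact ⟨_, Language.mem_kstar.2 ⟨l, rfl, fun q hq => mem_wordExpr.2 (hl q hq)⟩, w, hw, rfl⟩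

theorem exists_of_mem_starsExpr {P : List (List β)} {v : List β}
    (hv : v ∈ (starsExpr P).matches') : ∃ l ⊆ P, v = l.flatten := by
  induction P generalizing v with
  | nil => exact ⟨[], by simp, Set.mem_singleton_iff.1 hv⟩
  | cons p P ih =>
    obtain ⟨l, hl, w, hw, rfl⟩ := mem_starsExpr_cons.1 hv
    obtain ⟨l', hl', rfl⟩ := ih hw
    refine ⟨l ++ l', ?_, by simp⟩
    intro q hq
    rcases List.mem_append.1 hq with hq | hq
    · rw [hl q hq]
      exact List.mem_cons_self
    · exact List.mem_cons_of_mem _ (hl' hq)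

variable {G N α : Type*} [Group G] {x : α → G} {A : Subgroup G}

/-- Sorting the factors of `l` gives a word of `p₁* ⋯ pₖ*`. Only its value agrees with that of `l`,
which is all that is needed. -/
theorem exists_mem_starsExpr (hA : ∀ a ∈ A, ∀ b ∈ A, a * b = b * a) {P : List (SWord α)}
    (hP : ∀ p ∈ P, wordEval x p ∈ A) {l : List (SWord α)} (hl : l ⊆ P) :
    ∃ v ∈ (starsExpr P).matches', wordEval x v = wordEval x l.flatten := by
  induction P generalizing l with
  | nil =>
    obtain rfl := List.subset_nil.1 hl
    exact ⟨[], rfl, rfl⟩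
  | cons p P ih =>
    have hP' : ∀ q ∈ P, wordEval x q ∈ A := fun q hq => hP q (by simp [hq])
    obtain ⟨l₁, l₂, h1, h2, h3⟩ := wordEval_split hA (P := [p]) (Q := P)
      (by simpa using hP p (by simp)) hP' hl
    obtain ⟨w, hw, hw'⟩ := ih hP' h2
    refine ⟨l₁.flatten ++ w, mem_starsExpr_cons.2 ⟨l₁, fun q hq => ?_, w, hw, rfl⟩, ?_⟩
    · exact List.mem_singleton.1 (h1 hq)
    · rw [wordEval_append, hw', h3]

theorem mem_entryExpr {e : TableEntry N α} {v : SWord α} :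
    v ∈ (entryExpr e).matches' ↔ ∃ w ∈ (starsExpr e.2.1).matches', v = e.2.2 ++ (w ++ e.1.2.2) := by
  change v ∈ (wordExpr e.2.2).matches' * ((starsExpr e.2.1).matches' *
    (wordExpr e.1.2.2).matches') ↔ _
  simp only [Language.mem_mul, mem_wordExpr]
  constructor
  · rintro ⟨_, rfl, _, ⟨w, hw, _, rfl, rfl⟩, rfl⟩
    exact ⟨w, hw, rfl⟩
  · rintro ⟨w, hw, rfl⟩
    exact ⟨_, rfl, _, ⟨w, hw, _, rfl, rfl⟩, rfl⟩

theorem mem_tableExpr {n : N} {T : List (TableEntry N α)} {v : SWord α} :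
    v ∈ (tableExpr n T).matches' ↔
      ∃ e ∈ T, (e.1.1 = [] ∧ e.1.2.1 = [Sum.inl n]) ∧ v ∈ (entryExpr e).matches' := by
  have key : ∀ T : List (TableEntry N α), v ∈ (T.foldr
      (fun e E => RegularExpression.plus (entryExpr e) E) .zero).matches' ↔
      ∃ e ∈ T, v ∈ (entryExpr e).matches' := by
    intro T
    induction T with
    | nil => simp
    | cons e T ih =>
      rw [List.foldr_cons]
      change v ∈ (entryExpr e).matches' + _ ↔ _
      rw [Language.mem_add, ih]
      simp
  rw [tableExpr, key]
  simp [and_assoc]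

theorem image_tableExpr (hA : ∀ a ∈ A, ∀ b ∈ A, a * b = b * a) {rules : List (N × SForm N α)}
    {Q : List (SWord α)} {T : List (TableEntry N α)}
    (hC : IsCertificate (fun u v => wordEval x u = wordEval x v) (fun w => wordEval x w ∈ A)
      rules Q T) (n : N) :
    wordEval x '' ((tableExpr n T).matches' : Set (SWord α)) =
      {g | Yield rules x [Sum.inl n] g} := by
  ext g
  rw [Set.mem_ofPred_eq, yield_iff_of_isCertificate hA hC]
  constructor
  · rintro ⟨v, hv, rfl⟩
    obtain ⟨e, he, ⟨h1, h2⟩, hv⟩ := mem_tableExpr.1 hv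
    obtain ⟨w, hw, rfl⟩ := mem_entryExpr.1 hv
    obtain ⟨l, hl, rfl⟩ := exists_of_mem_starsExpr hw
    exact ⟨e, he, h1, h2, l, hl, by simp [mul_assoc]⟩
  · rintro ⟨e, he, h1, h2, l, hl, rfl⟩
    obtain ⟨-, h3, -⟩ := judgement_sound hA (hC.lower e he)
    obtain ⟨w, hw, hwl⟩ := exists_mem_starsExpr hA h3 hl
    exact ⟨_, mem_tableExpr.2 ⟨e, he, ⟨h1, h2⟩, mem_entryExpr.2 ⟨w, hw, rfl⟩⟩,
      by simp [mul_assoc, hwl]⟩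

end Expr

/-! ### Regularity of finite languages, products and stars by counting left quotients -/

namespace Language

variable {β : Type*} {L M : Language β}

/-- Every left quotient is a set of suffixes of words of `L`, and there are finitely many such sets.
-/
theorem IsRegular.of_finite (h : Set.Finite (L : Set (List β))) : L.IsRegular := by
  refine .of_finite_range_leftQuotient ?_
  have hs : {v | ∃ w ∈ (L : Set (List β)), v <:+ w}.Finite := by
    have : {v | ∃ w ∈ (L : Set (List β)), v <:+ w} = ⋃ w ∈ (L : Set (List β)),
        {v | v ∈ w.tails} := by
      ext v
      simp
    rw [this]
    exact h.biUnion fun w _ => List.finite_toSet _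
  refine hs.finite_subsets.subset ?_
  rintro _ ⟨w, rfl⟩ v hv
  exact ⟨w ++ v, hv, List.suffix_append _ _⟩

/-- The quotient of `L * M` by `w` is `(w⁻¹L) M` together with the union of the `v⁻¹M` over
splittings `w = u v` with `u ∈ L`, so finitely many quotients occur. -/
theorem IsRegular.mul (hL : L.IsRegular) (hM : M.IsRegular) : (L * M).IsRegular := by
  refine .of_finite_range_leftQuotient ?_
  have h1 := hL.finite_range_leftQuotient
  have h2 := hM.finite_range_leftQuotient
  let U : Set (Language β) → Language β := fun s => {v | ∃ q ∈ s, v ∈ q}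
  let F : Language β × Set (Language β) → Language β := fun y => y.1 * M + U y.2
  refine ((h1.prod h2.finite_subsets).image F).subset ?_
  rintro _ ⟨w, rfl⟩
  refine ⟨(L.leftQuotient w, {q | ∃ u v, u ∈ L ∧ u ++ v = w ∧ q = M.leftQuotient v}),
    ⟨⟨w, rfl⟩, ?_⟩, ?_⟩
  · rintro _ ⟨u, v, -, -, rfl⟩
    exact ⟨v, rfl⟩
  ext y
  rw [mem_leftQuotient, mem_mul]
  change y ∈ L.leftQuotient w * M ∨ y ∈ U _ ↔ _
  constructor
  · rintro (h | ⟨_, ⟨u, v, hu, rfl, rfl⟩, hy⟩)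
    · obtain ⟨a, ha, b, hb, rfl⟩ := mem_mul.1 h
      exact ⟨w ++ a, ha, b, hb, by simp⟩
    · exact ⟨u, hu, v ++ y, hy, by simp⟩
  · rintro ⟨a, ha, b, hb, hab⟩
    rcases List.append_eq_append_iff.1 hab with ⟨c, rfl, rfl⟩ | ⟨c, rfl, rfl⟩
    · exact Or.inr ⟨_, ⟨a, c, ha, rfl, rfl⟩, hb⟩
    · exact Or.inl (mem_mul.2 ⟨c, ha, b, hb, rfl⟩)

/-- For nonempty `w` the quotient of the star is a union of quotients `v⁻¹L`, over `w = u v` with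
`u` in the star, followed by the star. -/
theorem IsRegular.kstar (hL : L.IsRegular) : (KStar.kstar L).IsRegular := by
  refine .of_finite_range_leftQuotient ?_
  have h1 := hL.finite_range_leftQuotient
  let U : Set (Language β) → Language β := fun s => {v | ∃ q ∈ s, v ∈ q}
  let F : Set (Language β) → Language β := fun s => U s * KStar.kstar L
  refine ((h1.finite_subsets.image F).insert (KStar.kstar L)).subset ?_
  rintro _ ⟨w, rfl⟩
  by_cases hw : w = []
  · subst hw
    exact Or.inl rfl
  refine Or.inr ⟨{q | ∃ u v, u ∈ KStar.kstar L ∧ u ++ v = w ∧ q = L.leftQuotient v}, ?_, ?_⟩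
  · rintro _ ⟨u, v, -, -, rfl⟩
    exact ⟨v, rfl⟩
  -- Locates the factor in which `w` ends: `u` is the product of the earlier factors, and `v ++ c`
  -- is that factor.
  have key : ∀ l : List (List β), (∀ z ∈ l, z ∈ L) → ∀ w y, w ≠ [] → w ++ y = l.flatten →
      ∃ u v c d, u ∈ KStar.kstar L ∧ u ++ v = w ∧ v ++ c ∈ L ∧ d ∈ KStar.kstar L ∧
        y = c ++ d := by
    intro l
    induction l with
    | nil =>
      intro _ w y hw h
      simp [hw] at h
    | cons z l ih =>
      intro hl w y hw h
      have hz : z ∈ L := hl z (by simp)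
      have hl' : ∀ z ∈ l, z ∈ L := fun z hz => hl z (by simp [hz])
      rcases List.append_eq_append_iff.1 h with ⟨c, rfl, rfl⟩ | ⟨c, rfl, hc⟩
      · exact ⟨[], w, c, l.flatten, nil_mem_kstar L, rfl, hz, mem_kstar.2 ⟨l, rfl, hl'⟩, rfl⟩
      -- If `w` ends at the boundary of `z`, then `v` is all of `z`; the induction hypothesis
      -- applies only to a nonempty rest.
      · by_cases hc0 : c = []
        · subst hc0
          simp only [List.nil_append] at hc
          subst hc
          exact ⟨[], z, [], l.flatten, nil_mem_kstar L, by simp, by simpa using hz,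
            mem_kstar.2 ⟨l, rfl, hl'⟩, rfl⟩
        · obtain ⟨u, v, c', d, hu, rfl, h3, h4, rfl⟩ := ih hl' c y hc0 hc.symm
          obtain ⟨l', rfl, hl''⟩ := mem_kstar.1 hu
          refine ⟨z ++ l'.flatten, v, c', d, mem_kstar.2 ⟨z :: l', rfl, ?_⟩, by simp, h3, h4, rfl⟩
          simpa [hz] using hl''
  ext y
  rw [mem_leftQuotient]
  change y ∈ U _ * KStar.kstar L ↔ _
  constructor
  · intro h
    obtain ⟨a, ⟨_, ⟨u, v, hu, rfl, rfl⟩, ha⟩, b, hb, rfl⟩ := mem_mul.1 h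
    obtain ⟨l, rfl, hl⟩ := mem_kstar.1 hu
    obtain ⟨l', rfl, hl'⟩ := mem_kstar.1 hb
    refine mem_kstar.2 ⟨l ++ (v ++ a) :: l', by simp, ?_⟩
    intro z hz
    simp only [List.mem_append, List.mem_cons] at hz
    rcases hz with hz | rfl | hz
    · exact hl z hz
    · exact ha
    · exact hl' z hz
  · intro h
    obtain ⟨l, h, hl⟩ := mem_kstar.1 h
    obtain ⟨u, v, c, d, hu, huv, hc, hd, rfl⟩ := key l hl w y hw h
    exact mem_mul.2 ⟨c, ⟨_, ⟨u, v, hu, huv, rfl⟩, hc⟩, d, hd, rfl⟩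

end Language

theorem RegularExpression.isRegular_matches' {β : Type*} (E : RegularExpression β) :
    E.matches'.IsRegular := by
  induction E with
  | zero => exact .of_finite (Set.finite_empty)
  | epsilon => exact .of_finite (Set.finite_singleton [])
  | char a => exact .of_finite (Set.finite_singleton [a])
  | plus P Q hP hQ => exact hP.add hQ
  | comp P Q hP hQ => exact hP.mul hQ
  | star P hP => exact hP.kstar

/-! ### Context-free grammars -/

section Grammar

variable {G N α : Type*} [Group G] {x : α → G}

theorem yield_append {rules : List (N × SForm N α)} {u v : SForm N α} {g : G} :
    Yield rules x (u ++ v) g ↔ ∃ a b, Yield rules x u a ∧ Yield rules x v b ∧ g = a * b := by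
  induction u generalizing g with
  | nil =>
    constructor
    · exact fun h => ⟨1, g, .nil, h, by simp⟩
    · rintro ⟨a, b, ha, hb, rfl⟩
      cases ha
      simpa using hb
  | cons s u ih =>
    constructor
    · intro h
      cases h with
      | terminal c _ h hβ =>
        obtain ⟨a, b, ha, hb, rfl⟩ := ih.1 hβ
        exact ⟨_, b, .terminal c _ _ ha, hb, by rw [mul_assoc]⟩
      | nonterminal n κ _ g h hn hκ hβ =>
        obtain ⟨a, b, ha, hb, rfl⟩ := ih.1 hβ
        exact ⟨_, b, .nonterminal n _ _ _ _ hn hκ ha, hb, by rw [mul_assoc]⟩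
    · rintro ⟨a, b, ha, hb, rfl⟩
      cases ha with
      | terminal c _ h hβ =>
        rw [mul_assoc]
        exact .terminal c _ _ (ih.2 ⟨_, _, hβ, hb, rfl⟩)
      | nonterminal n κ _ g h hn hκ hβ =>
        rw [mul_assoc]
        exact .nonterminal n _ _ _ _ hn hκ (ih.2 ⟨_, _, hβ, hb, rfl⟩)

/-- A sentential form as a list of symbols. -/
def formSymbols {N T : Type*} (κ : List (N ⊕ T)) : List (Symbol T N) :=
  κ.map (Sum.elim Symbol.nonterminal Symbol.terminal)

theorem formSymbols_injective {N T : Type*} :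
    Function.Injective (formSymbols : List (N ⊕ T) → List (Symbol T N)) := by
  refine List.map_injective_iff.2 ?_
  rintro (a | a) (b | b) h <;> simp_all

/-- Passes between rewriting sequences and the structural relation `Yield`, which suits inductions
on parse trees. -/
theorem image_language_eq {C : ContextFreeGrammar (α × Bool)}
    {rules : List (C.NT × SForm C.NT α)}
    (hR : ∀ r, r ∈ C.rules ↔ ∃ p ∈ rules, r = ⟨p.1, formSymbols p.2⟩) :
    wordEval x '' (C.language : Set (SWord α)) =
      {g | Yield rules x [Sum.inl C.initial] g} := by
  have h1 : ∀ κ g, Yield rules x κ g → ∃ w : SWord α,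
      C.Derives (formSymbols κ) (w.map Symbol.terminal) ∧ wordEval x w = g := by
    intro κ g h
    induction h with
    | nil => exact ⟨[], .refl _, rfl⟩
    | terminal a β h hβ ih =>
      obtain ⟨w, hw, rfl⟩ := ih
      exact ⟨a :: w, hw.append_left [Symbol.terminal a], wordEval_cons x a w⟩
    | nonterminal n κ β g h hn hκ hβ ihκ ihβ =>
      obtain ⟨w, hw, rfl⟩ := ihκ
      obtain ⟨v, hv, rfl⟩ := ihβ
      refine ⟨w ++ v, ?_, wordEval_append x w v⟩
      have hp : C.Produces [Symbol.nonterminal n] (formSymbols κ) :=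
        ⟨⟨n, formSymbols κ⟩, (hR _).2 ⟨_, hn, rfl⟩, ContextFreeRule.Rewrites.input_output⟩
      have h2 := (hp.single.trans hw).append_right (formSymbols β)
      rw [List.map_append]
      exact h2.trans (hv.append_left _)
  have h2 : ∀ (w : SWord α) κ, C.Derives (formSymbols κ) (w.map Symbol.terminal) →
      Yield rules x κ (wordEval x w) := by
    intro w κ h
    generalize hu : formSymbols κ = u at h
    -- Removes the first rewriting step: a yield of the rewritten form is split at the inserted
    -- right-hand side, whose part becomes a yield of the replaced nonterminal.
    induction h using Relation.ReflTransGen.head_induction_on generalizing κ with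
    | refl =>
      have : κ = w.map Sum.inr := formSymbols_injective (by rw [hu]; simp [formSymbols])
      subst this
      clear hu
      induction w with
      | nil => exact .nil
      | cons a w ih =>
        rw [wordEval_cons]
        exact .terminal a _ _ ih
    | head hp _ ih =>
      obtain ⟨r, hr, hrw⟩ := hp
      obtain ⟨⟨n, κ'⟩, hn, rfl⟩ := (hR _).1 hr
      obtain ⟨p, q, rfl, rfl⟩ := hrw.exists_parts
      obtain ⟨κ₀, q', rfl, h3, rfl⟩ := List.map_eq_append_iff.1 hu
      obtain ⟨p', s, rfl, rfl, h4⟩ := List.map_eq_append_iff.1 h3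
      have hs : s = [Sum.inl n] := formSymbols_injective h4
      subst hs
      have := ih (p' ++ κ' ++ q') (by simp [formSymbols])
      obtain ⟨a, b, ha, hb, hab⟩ := yield_append.1 this
      obtain ⟨c, d, hc, hd, rfl⟩ := yield_append.1 ha
      rw [hab]
      have h5 := Yield.nonterminal n κ' [] d 1 hn hd .nil
      rw [mul_one] at h5
      exact yield_append.2 ⟨_, _, yield_append.2 ⟨_, _, hc, h5, rfl⟩, hb, rfl⟩
  ext g
  constructor
  · rintro ⟨w, hw, rfl⟩
    exact h2 w _ hw
  · intro h
    obtain ⟨w, hw, rfl⟩ := h1 _ _ h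
    exact ⟨w, hw, rfl⟩

theorem exists_word_of_mem_closure {s : Set α} {g : G} (hg : g ∈ Subgroup.closure (x '' s)) :
    ∃ w : SWord α, (∀ a ∈ w, a.1 ∈ s) ∧ wordEval x w = g := by
  induction hg using Subgroup.closure_induction_left with
  | one => exact ⟨[], by simp, rfl⟩
  | mul_left y hy z _ ih =>
    obtain ⟨i, hi, rfl⟩ := hy
    obtain ⟨w, hw, rfl⟩ := ih
    refine ⟨(i, true) :: w, by simpa [hi] using hw, ?_⟩
    rw [wordEval_cons]
    simp [wordEval]
  | inv_mul_cancel y hy z _ ih =>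
    obtain ⟨i, hi, rfl⟩ := hy
    obtain ⟨w, hw, rfl⟩ := ih
    refine ⟨(i, false) :: w, by simpa [hi] using hw, ?_⟩
    rw [wordEval_cons]
    simp [wordEval]

theorem isRationalSubset_of_isContextFreeSubset (hG : IsVirtuallyAbelian G)
    (hx : Subgroup.closure (Set.range x) = ⊤) {C : Set G} (hC : IsContextFreeSubset x C) :
    IsRationalSubset x C := by
  obtain ⟨A, hfin, hA⟩ := hG
  obtain ⟨_, ⟨Γ, rfl⟩, rfl⟩ := hC
  have hsurj : ∀ g, ∃ w : SWord α, True ∧ wordEval x w = g := by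
    intro g
    obtain ⟨w, -, hw⟩ := exists_word_of_mem_closure (x := x) (s := Set.univ) (g := g)
      (by rw [Set.image_univ, hx]; trivial)
    exact ⟨w, trivial, hw⟩
  let rules : List (Γ.NT × SForm Γ.NT α) := Γ.rules.toList.map fun r =>
    (r.input, r.output.map fun s => match s with
      | .nonterminal n => Sum.inl n
      | .terminal a => Sum.inr a)
  have hR : ∀ r, r ∈ Γ.rules ↔ ∃ p ∈ rules, r = ⟨p.1, formSymbols p.2⟩ := by
    intro r
    have hr : ∀ r : ContextFreeRule (α × Bool) Γ.NT, (⟨r.input, formSymbols (r.output.map fun s =>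
        match s with
        | .nonterminal n => Sum.inl n
        | .terminal a => Sum.inr a)⟩ : ContextFreeRule (α × Bool) Γ.NT) = r := by
      rintro ⟨n, κ⟩
      congr
      simp only [formSymbols, List.map_map]
      refine (List.map_congr_left fun s _ => ?_).trans (List.map_id _)
      cases s <;> rfl
    simp [rules, hr]
  obtain ⟨Q, T, hT, -⟩ := exists_certificate hA (ok := fun _ => True) trivial hsurj rules
  refine ⟨(tableExpr Γ.initial T).matches', RegularExpression.isRegular_matches' _, ?_⟩
  rw [image_tableExpr hA hT, image_language_eq hR]

end Grammar

/-! ### The word problem for described groups -/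

section WordProblem

theorem closure_commute {G : Type*} [Group G] {s : Set G}
    (h : ∀ x ∈ s, ∀ y ∈ s, x * y = y * x) :
    ∀ x ∈ Subgroup.closure s, ∀ y ∈ Subgroup.closure s, x * y = y * x := by
  have h1 : Subgroup.closure s ≤ Subgroup.centralizer s :=
    (Subgroup.closure_le _).2 fun x hx => Subgroup.mem_centralizer_iff.2 fun y hy => h y hy x hx
  have h2 : Subgroup.closure s ≤ Subgroup.centralizer (Subgroup.closure s : Set G) :=
    (Subgroup.closure_le _).2 fun x hx => Subgroup.mem_centralizer_iff.2 fun y hy =>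
      (Subgroup.mem_centralizer_iff.1 (h1 hy) x hx).symm
  exact fun x hx y hy => (Subgroup.mem_centralizer_iff.1 (h2 hx) y hy).symm

theorem exists_eq_prod_ofFn {G : Type*} [Group G] {n : ℕ} {v : ℕ → G}
    (h : ∀ i < n, ∀ j < n, v i * v j = v j * v i) {g : G}
    (hg : g ∈ Subgroup.closure (v '' Set.Iio n)) :
    ∃ e : Fin n → ℤ, g = (List.ofFn fun i : Fin n => v i ^ e i).prod := by
  let C := Subgroup.closure (v '' Set.Iio n)
  have hC : ∀ x ∈ C, ∀ y ∈ C, x * y = y * x := closure_commute (by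
    rintro _ ⟨i, hi, rfl⟩ _ ⟨j, hj, rfl⟩
    exact h i hi j hj)
  let _ : CommGroup C := { (inferInstance : Group C) with
    mul_comm := fun a b => Subtype.ext (hC a a.2 b b.2) }
  let w : Fin n → C := fun i => ⟨v i, Subgroup.subset_closure ⟨i, i.2, rfl⟩⟩
  have hw : (⟨g, hg⟩ : C) ∈ Subgroup.closure (Set.range w) := by
    have : Subgroup.map C.subtype (Subgroup.closure (Set.range w)) = C := by
      rw [MonoidHom.map_closure]
      congr 1
      ext y
      constructor
      · rintro ⟨_, ⟨i, rfl⟩, rfl⟩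
        exact ⟨i, i.2, rfl⟩
      · rintro ⟨i, hi, rfl⟩
        exact ⟨_, ⟨⟨i, hi⟩, rfl⟩, rfl⟩
    have hg' : g ∈ Subgroup.map C.subtype (Subgroup.closure (Set.range w)) := by
      rw [this]
      exact hg
    obtain ⟨y, hy, rfl⟩ := hg'
    exact hy
  obtain ⟨e, he⟩ := Subgroup.exists_of_mem_closure_range w _ hw
  refine ⟨e, ?_⟩
  rw [← List.prod_ofFn] at he
  have := congrArg C.subtype he
  rw [map_list_prod, List.map_ofFn] at this
  exact this

variable {G : Type*} [Group G]

theorem wordEval_flatMap {α ι : Type*} (x : α → G) (l : List ι) (f : ι → SWord α) :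
    wordEval x (l.flatMap f) = (l.map fun i => wordEval x (f i)).prod := by
  induction l with
  | nil => rfl
  | cons i l ih => simp [ih]

theorem wordEval_normalWord {D : VADescription} (x : BTName → G) (e : Fin D.rank → ℤ) (j : ℕ) :
    wordEval x (D.normalWord e j) =
      (List.ofFn fun i : Fin D.rank => x (Sum.inl i) ^ e i).prod * x (Sum.inr j) := by
  rw [VADescription.normalWord, wordEval_append, wordEval_flatMap, List.ofFn_eq_map]
  congr 1
  · congr 2
    funext i
    simp only [wordEval, List.map_replicate, List.prod_replicate]
    rcases le_or_gt 0 (e i) with h | h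
    · obtain ⟨n, hn⟩ := Int.eq_ofNat_of_zero_le h
      simp [hn]
    · obtain ⟨n, hn⟩ := Int.eq_ofNat_of_zero_le (neg_nonneg.2 h.le)
      have he : e i = -(n : ℤ) := by omega
      have h' : ¬ 0 ≤ e i := not_le.2 h
      simp only [h', decide_false, Bool.false_eq_true, if_false]
      simp [he]
  · simp [wordEval]

namespace VADescription.Describes

variable {D : VADescription} {b t : ℕ → G} (hD : D.Describes b t)

include hD

theorem baseSubgroup_comm :
    ∀ x ∈ D.baseSubgroup b, ∀ y ∈ D.baseSubgroup b, x * y = y * x :=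
  closure_commute (by
    rintro _ ⟨i, hi, rfl⟩ _ ⟨j, hj, rfl⟩
    exact hD.basis_comm i hi j hj)

theorem finiteIndex : (D.baseSubgroup b).FiniteIndex :=
  hD.transversal.finite_right_iff.1 ((Set.finite_Iio D.index).image t)

theorem mul_transversal_inj {β β' : G} (hβ : β ∈ D.baseSubgroup b) (hβ' : β' ∈ D.baseSubgroup b)
    {j j' : ℕ} (hj : j < D.index) (hj' : j' < D.index) (h : β * t j = β' * t j') :
    β = β' ∧ j = j' := by
  have h1 : (⟨⟨β, hβ⟩, ⟨t j, j, hj, rfl⟩⟩ :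
      Prod (D.baseSubgroup b : Set G) (t '' Set.Iio D.index)) =
      ⟨⟨β', hβ'⟩, ⟨t j', j', hj', rfl⟩⟩ := hD.transversal.1 h
  exact ⟨congrArg (fun z => (z.1 : G)) h1,
    hD.transversal_inj hj hj' (congrArg (fun z => (z.2 : G)) h1)⟩

theorem index_pos : 0 < D.index := by
  obtain ⟨⟨-, ⟨_, j, hj, rfl⟩⟩, -⟩ := hD.transversal.2 1
  exact Nat.zero_lt_of_lt hj

omit hD in
theorem prod_mem (e : Fin D.rank → ℤ) :
    (List.ofFn fun i : Fin D.rank => b i ^ e i).prod ∈ D.baseSubgroup b := by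
  refine Subgroup.list_prod_mem _ fun y hy => ?_
  obtain ⟨i, rfl⟩ := List.mem_ofFn.1 hy
  have hi : b i ∈ D.baseSubgroup b := Subgroup.subset_closure ⟨i, i.2, rfl⟩
  exact Subgroup.zpow_mem _ hi _

/-- The relations of the table present the group. -/
theorem eq_one_of_map_eq_one {H : Type*} [Group H] (f : H →* G) {b' t' : ℕ → H}
    (hb : ∀ i, f (b' i) = b i) (ht : ∀ j, f (t' j) = t j)
    (htab : ∀ e ∈ D.table, wordEval (Sum.elim b' t') [e.1.1, e.1.2] =
      wordEval (Sum.elim b' t') e.2) {h : H}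
    (hh : h ∈ Subgroup.closure (Sum.elim b' t' '' {n | D.IsName n})) (hf : f h = 1) : h = 1 := by
  let A := Subgroup.closure (b' '' Set.Iio D.rank)
  have hfA : ∀ a ∈ A, f a ∈ D.baseSubgroup b := by
    have : A.map f ≤ D.baseSubgroup b := by
      rw [MonoidHom.map_closure, Subgroup.closure_le]
      rintro _ ⟨_, ⟨i, hi, rfl⟩, rfl⟩
      rw [hb]
      exact Subgroup.subset_closure ⟨i, hi, rfl⟩
    exact fun a ha => this ⟨a, ha, rfl⟩
  have hprodA : ∀ e : Fin D.rank → ℤ, (List.ofFn fun i : Fin D.rank => b' i ^ e i).prod ∈ A := by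
    intro e
    refine Subgroup.list_prod_mem _ fun y hy => ?_
    obtain ⟨i, rfl⟩ := List.mem_ofFn.1 hy
    have hi : b' i ∈ A := Subgroup.subset_closure ⟨i, i.2, rfl⟩
    exact Subgroup.zpow_mem _ hi _
  -- products of two letters
  have hpair : ∀ a c : BTName × Bool, D.IsName a.1 → D.IsName c.1 →
      ∃ (e : Fin D.rank → ℤ) (j : ℕ), j < D.index ∧
      wordEval (Sum.elim b' t') [a, c] =
        (List.ofFn fun i : Fin D.rank => b' i ^ e i).prod * t' j ∧
      wordEval (Sum.elim b t) [a, c] = (List.ofFn fun i : Fin D.rank => b i ^ e i).prod * t j := by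
    intro a c ha hc
    obtain ⟨w, hw⟩ := hD.table_total a c ha hc
    obtain ⟨-, -, ⟨e, j, hj, rfl⟩, hw2⟩ := hD.table_spec a c w hw
    refine ⟨e, j, hj, ?_, ?_⟩
    · rw [htab _ hw, wordEval_normalWord]
      rfl
    · rw [← hw2, wordEval_normalWord]
      rfl
  -- The table gives normal forms of `b i * b j` and `b j * b i` valid in both groups. The two
  -- products agree in `G`, where normal forms are unique, so they agree in `H`.
  have hcomm : ∀ i < D.rank, ∀ j < D.rank, b' i * b' j = b' j * b' i := by
    intro i hi j hj
    obtain ⟨e, k, hk, h1, h2⟩ := hpair (Sum.inl i, true) (Sum.inl j, true) hi hj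
    obtain ⟨e', k', hk', h1', h2'⟩ := hpair (Sum.inl j, true) (Sum.inl i, true) hj hi
    simp only [wordEval, List.map_cons, List.map_nil, if_true, Sum.elim_inl, List.prod_cons,
      List.prod_nil, mul_one] at h1 h2 h1' h2'
    rw [hD.basis_comm i hi j hj, h2'] at h2
    obtain ⟨h3, rfl⟩ := hD.mul_transversal_inj (prod_mem e') (prod_mem e) hk' hk h2
    obtain rfl := hD.basis_free h3
    rw [h1, h1']
  -- An element of `A` is a product of powers of the `b' i`, and freeness of the basis in `G` forces
  -- all exponents to vanish.
  have hinjA : ∀ a ∈ A, f a = 1 → a = 1 := by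
    intro a ha hfa
    obtain ⟨e, rfl⟩ := exists_eq_prod_ofFn hcomm ha
    rw [map_list_prod, List.map_ofFn] at hfa
    have h0 : (fun i => 0 : Fin D.rank → ℤ) = e := by
      apply hD.basis_free
      have : (⇑f ∘ fun i : Fin D.rank => b' i ^ e i) = fun i : Fin D.rank => b i ^ e i := by
        funext i
        simp [hb]
      rw [this] at hfa
      simp only [hfa]
      simp
    subst h0
    simp
  have hname : ∀ h ∈ Subgroup.closure (Sum.elim b' t' '' {n | D.IsName n}),
      ∃ a ∈ A, ∃ j < D.index, h = a * t' j := by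
    intro h hh
    have hletter : ∀ (a : H) (j : ℕ), a ∈ A → j < D.index → ∀ c : BTName × Bool, D.IsName c.1 →
        ∃ a' ∈ A, ∃ j' < D.index, a * t' j * wordEval (Sum.elim b' t') [c] = a' * t' j' := by
      intro a j ha hj c hc
      obtain ⟨e, k, hk, h1, -⟩ := hpair (Sum.inr j, true) c hj hc
      refine ⟨_, A.mul_mem ha (hprodA e), k, hk, ?_⟩
      rw [mul_assoc, mul_assoc, ← h1, wordEval_cons _ _ [c]]
      simp [wordEval]
    induction hh using Subgroup.closure_induction_right with
    | one =>
      -- The transversal need not contain `1`, so the normal form of `1` is read from the entry for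
      -- `t₀ t₀⁻¹`.
      obtain ⟨e, k, hk, h1, -⟩ := hpair (Sum.inr 0, true) (Sum.inr 0, false) hD.index_pos
        hD.index_pos
      refine ⟨_, hprodA e, k, hk, ?_⟩
      rw [← h1]
      simp [wordEval]
    | mul_right y _ z hz ih =>
      obtain ⟨a, ha, j, hj, rfl⟩ := ih
      obtain ⟨n, hn, rfl⟩ := hz
      simpa [wordEval] using hletter a j ha hj (n, true) hn
    | mul_inv_cancel y _ z hz ih =>
      obtain ⟨a, ha, j, hj, rfl⟩ := ih
      obtain ⟨n, hn, rfl⟩ := hz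
      simpa [wordEval] using hletter a j ha hj (n, false) hn
  obtain ⟨a, ha, j, hj, rfl⟩ := hname h hh
  -- Comparing the normal forms of `h` and `1` in `G` gives the same transversal index and the same
  -- image in `A`; injectivity on `A` finishes.
  obtain ⟨a₁, ha₁, j₁, hj₁, h1⟩ := hname 1 (one_mem _)
  have h2 : f a * t j = f a₁ * t j₁ := by
    rw [← ht, ← ht, ← map_mul, ← map_mul, hf, ← h1, map_one]
  obtain ⟨h3, rfl⟩ := hD.mul_transversal_inj (hfA _ ha) (hfA _ ha₁) hj hj₁ h2
  have h4 : a * a₁⁻¹ = 1 := hinjA _ (A.mul_mem ha (A.inv_mem ha₁)) (by simp [h3])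
  rw [h1, mul_inv_eq_one.1 h4]

end VADescription.Describes

/-! ### Formal derivation of equalities from the table -/

/-- Names of listed elements, basis elements and transversal elements. -/
abbrev ListedName := ℕ ⊕ BTName

/-- A word over `B ∪ T` as a word over all names. -/
def liftWord (w : SWord BTName) : SWord ListedName := w.map fun a => (Sum.inr a.1, a.2)

/-- A word over the listed elements as a word over all names. -/
def listedWord (w : SWord ℕ) : SWord ListedName := w.map fun a => (Sum.inl a.1, a.2)

/-- A word over `B` as a word over all names. -/
def basisWord (w : SWord ℕ) : SWord ListedName := w.map fun a => (Sum.inr (Sum.inl a.1), a.2)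

/-- The rules for the derivation of equalities of words. -/
def EqRule (D : VADescription) (gens : List (SWord BTName))
    (prem : List (SWord ListedName × SWord ListedName))
    (j : SWord ListedName × SWord ListedName) : Prop :=
  j.1 = j.2 ∨ (j.2, j.1) ∈ prem ∨ (∃ w, (j.1, w) ∈ prem ∧ (w, j.2) ∈ prem) ∨
  (∃ p q : SWord ListedName × SWord ListedName, p ∈ prem ∧ q ∈ prem ∧ j.1 = p.1 ++ q.1 ∧
    j.2 = p.2 ++ q.2) ∨
  (∃ (n : ListedName) (s : Bool), j.1 = [(n, s), (n, !s)] ∧ j.2 = []) ∨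
  (∃ e, e ∈ D.table ∧ j.1 = liftWord [e.1.1, e.1.2] ∧ j.2 = liftWord e.2) ∨
  (∃ i, j.1 = [(Sum.inl i, true)] ∧ j.2 = liftWord (gens.getD i []))

/-- The equality of the values of two words is derivable from a description. -/
def ProvablyEq (D : VADescription) (gens : List (SWord BTName)) (u v : SWord ListedName) : Prop :=
  Derivable (EqRule D gens) (u, v)

/-- The values of all names. -/
def listedVal (b t : ℕ → G) (gens : List (SWord BTName)) : ListedName → G :=
  Sum.elim (listedElement b t gens) (Sum.elim b t)

theorem wordEval_map {α β : Type*} (x : α → G) (f : β → α) (w : SWord β) :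
    wordEval x (w.map fun a => (f a.1, a.2)) = wordEval (fun i => x (f i)) w := by
  simp only [wordEval, List.map_map]
  rfl

theorem wordEval_liftWord (b t : ℕ → G) (gens : List (SWord BTName)) (w : SWord BTName) :
    wordEval (listedVal b t gens) (liftWord w) = wordEval (Sum.elim b t) w :=
  wordEval_map _ _ _

theorem wordEval_listedWord (b t : ℕ → G) (gens : List (SWord BTName)) (w : SWord ℕ) :
    wordEval (listedVal b t gens) (listedWord w) = wordEval (listedElement b t gens) w :=
  wordEval_map _ _ _

theorem wordEval_basisWord (b t : ℕ → G) (gens : List (SWord BTName)) (w : SWord ℕ) :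
    wordEval (listedVal b t gens) (basisWord w) = wordEval b w :=
  wordEval_map _ (fun i => Sum.inr (Sum.inl i)) _

theorem ProvablyEq.eval_eq {D : VADescription} {b t : ℕ → G} (hD : D.Describes b t)
    {gens : List (SWord BTName)} {u v : SWord ListedName} (h : ProvablyEq D gens u v) :
    wordEval (listedVal b t gens) u = wordEval (listedVal b t gens) v := by
  have key : ∀ j, Derivable (EqRule D gens) j →
      wordEval (listedVal b t gens) j.1 = wordEval (listedVal b t gens) j.2 := by
    intro j hj
    induction hj with
    | intro prem j _ h ih =>
      rcases h with h | h | ⟨w, h1, h2⟩ | ⟨p, q, hp, hq, h1, h2⟩ | ⟨n, s, h1, h2⟩ |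
        ⟨e, he, h1, h2⟩ | ⟨i, h1, h2⟩
      · rw [h]
      · exact (ih _ h).symm
      · exact (ih _ h1).trans (ih _ h2)
      · rw [h1, h2, wordEval_append, wordEval_append, ih _ hp, ih _ hq]
      · rw [h1, h2]
        cases s <;> simp [wordEval]
      · rw [h1, h2, wordEval_liftWord, wordEval_liftWord]
        exact (hD.table_spec _ _ _ he).2.2.2.symm
      · rw [h1, h2, wordEval_liftWord]
        simp [wordEval, listedVal, listedElement]
  exact key _ h

/-- The congruence of derivable equality. -/
def provablyEqCon (D : VADescription) (gens : List (SWord BTName)) :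
    Con (FreeMonoid (ListedName × Bool)) where
  r u v := ProvablyEq D gens u.toList v.toList
  iseqv :=
    ⟨fun u => ⟨[], _, by simp, Or.inl rfl⟩,
     fun {u v} h => ⟨[(u.toList, v.toList)], _, by simpa [ProvablyEq] using h,
      Or.inr (Or.inl (by simp))⟩,
     fun {u v w} h h' => ⟨[(u.toList, v.toList), (v.toList, w.toList)], _,
      by simpa [ProvablyEq] using And.intro h h', Or.inr (Or.inr (Or.inl ⟨v.toList, by simp⟩))⟩⟩
  mul' {u v w z} h h' := ⟨[(u.toList, v.toList), (w.toList, z.toList)], _,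
    by simpa [ProvablyEq] using And.intro h h', Or.inr (Or.inr (Or.inr (Or.inl
      ⟨(u.toList, v.toList), (w.toList, z.toList), by simp⟩)))⟩

/-- A word over all names all of whose letters occur in the description. -/
def IsListedWord (D : VADescription) (w : SWord ListedName) : Prop :=
  ∀ a ∈ w, Sum.elim (fun _ => True) D.IsName a.1

/-- Words modulo provable equality form a group that maps to `G` and satisfies the relations of the
table. Since these present `G`, the map is injective on the subgroup generated by the names of the
description, which contains all listed words. -/
theorem ProvablyEq.of_eval_eq {D : VADescription} {b t : ℕ → G} (hD : D.Describes b t)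
    {gens : List (SWord BTName)} (hgens : ∀ w ∈ gens, ∀ a ∈ w, D.IsName a.1)
    {u v : SWord ListedName} (hu : IsListedWord D u) (hv : IsListedWord D v)
    (h : wordEval (listedVal b t gens) u = wordEval (listedVal b t gens) v) :
    ProvablyEq D gens u v := by
  let c := provablyEqCon D gens
  let cls : SWord ListedName → c.Quotient := fun w => (FreeMonoid.ofList w : FreeMonoid _)
  have hcls : ∀ u v, cls u = cls v ↔ ProvablyEq D gens u v := fun u v => Con.eq c
  have happ : ∀ u v, cls (u ++ v) = cls u * cls v := fun u v => rfl
  have hnil : cls [] = 1 := rfl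
  have hcancel : ∀ n s, cls [(n, s)] * cls [(n, !s)] = 1 := by
    intro n s
    rw [← happ, ← hnil, hcls]
    exact ⟨[], _, by simp, Or.inr (Or.inr (Or.inr (Or.inr (Or.inl ⟨n, s, rfl, rfl⟩))))⟩
  have hunit : ∀ w, IsUnit (cls w) := by
    intro w
    induction w with
    | nil => exact isUnit_one
    | cons a w ih =>
      refine IsUnit.mul (a := cls [a]) ?_ ih
      have h2 := hcancel a.1 (!a.2)
      rw [Bool.not_not] at h2
      exact ⟨⟨cls [a], cls [(a.1, !a.2)], hcancel a.1 a.2, h2⟩, rfl⟩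
  have hunit' : ∀ y : c.Quotient, IsUnit y := by
    intro y
    induction y using Con.induction_on with
    | H w => exact hunit w.toList
  -- The cancellation rules make each letter, hence every class, invertible.
  let _ : Group c.Quotient := groupOfIsUnit hunit'
  let x' : ListedName → c.Quotient := fun n => cls [(n, true)]
  have heval : ∀ w, cls w = wordEval x' w := by
    intro w
    induction w with
    | nil => rfl
    | cons a w ih =>
      rw [wordEval_cons, ← ih]
      change cls [a] * cls w = _
      congr 1
      obtain ⟨n, s⟩ := a
      cases s
      · simp only [wordEval, List.map_cons, List.map_nil, List.prod_cons, List.prod_nil, mul_one]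
        exact eq_inv_of_mul_eq_one_left (hcancel n false)
      · simp [wordEval, x']
  let f : c.Quotient →* G := c.lift (FreeMonoid.lift fun a =>
    wordEval (listedVal b t gens) [a]) (by
      have hl : ∀ w : FreeMonoid (ListedName × Bool), FreeMonoid.lift (fun a =>
          wordEval (listedVal b t gens) [a]) w = wordEval (listedVal b t gens) w.toList := by
        intro w
        rw [FreeMonoid.lift_apply]
        simp [wordEval]
      intro u v huv
      rw [Con.ker_rel, hl, hl]
      exact ProvablyEq.eval_eq hD huv)
  have hf : ∀ w, f (cls w) = wordEval (listedVal b t gens) w := by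
    intro w
    change FreeMonoid.lift (fun a => wordEval (listedVal b t gens) [a]) (FreeMonoid.ofList w) = _
    rw [FreeMonoid.lift_apply]
    simp [wordEval]
  let b' : ℕ → c.Quotient := fun i => x' (Sum.inr (Sum.inl i))
  let t' : ℕ → c.Quotient := fun j => x' (Sum.inr (Sum.inr j))
  have hlift : ∀ w, cls (liftWord w) = wordEval (Sum.elim b' t') w := by
    intro w
    rw [heval, liftWord, wordEval_map]
    congr 1
    funext n
    cases n <;> rfl
  have hnamed : ∀ w : SWord BTName, (∀ a ∈ w, D.IsName a.1) →
      cls (liftWord w) ∈ Subgroup.closure (Sum.elim b' t' '' {n | D.IsName n}) := by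
    intro w hw
    rw [hlift]
    induction w with
    | nil => exact one_mem _
    | cons a w ih =>
      rw [wordEval_cons]
      refine mul_mem ?_ (ih fun c hc => hw c (by simp [hc]))
      have h1 : Sum.elim b' t' a.1 ∈ Subgroup.closure (Sum.elim b' t' '' {n | D.IsName n}) :=
        Subgroup.subset_closure ⟨_, hw a (by simp), rfl⟩
      obtain ⟨n, s⟩ := a
      cases s
      · simpa [wordEval] using h1
      · simpa [wordEval] using h1
  have hlisted : ∀ w, IsListedWord D w →
      cls w ∈ Subgroup.closure (Sum.elim b' t' '' {n | D.IsName n}) := by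
    intro w hw
    rw [heval]
    induction w with
    | nil => exact one_mem _
    | cons a w ih =>
      rw [wordEval_cons]
      refine mul_mem ?_ (ih fun c hc => hw c (by simp [hc]))
      have h1 : x' a.1 ∈ Subgroup.closure (Sum.elim b' t' '' {n | D.IsName n}) := by
        have ha := hw a (by simp)
        obtain ⟨i | n, s⟩ := a
        -- A listed element is provably equal to its defining word over `B ∪ T`; an index beyond the
        -- list defaults to the empty word.
        · have h2 : x' (Sum.inl i) = cls (liftWord (gens.getD i [])) := by
            rw [hcls]
            exact ⟨[], _, by simp, Or.inr (Or.inr (Or.inr (Or.inr (Or.inr (Or.inr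
              ⟨i, rfl, rfl⟩)))))⟩
          rw [h2]
          refine hnamed _ fun c hc => ?_
          rw [List.getD_eq_getElem?_getD] at hc
          rcases hi : gens[i]? with _ | w'
          · simp [hi] at hc
          · rw [hi] at hc
            exact hgens w' (List.mem_of_getElem? hi) c hc
        · refine Subgroup.subset_closure ⟨n, ha, ?_⟩
          cases n <;> rfl
      obtain ⟨n, s⟩ := a
      cases s
      · simpa [wordEval] using h1
      · simpa [wordEval] using h1
  rw [← hcls]
  refine mul_inv_eq_one.1 (hD.eq_one_of_map_eq_one f (b' := b') (t' := t') ?_ ?_ ?_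
    (mul_mem (hlisted u hu) (inv_mem (hlisted v hv))) ?_)
  · intro i
    rw [hf]
    simp [wordEval, listedVal]
  · intro j
    rw [hf]
    simp [wordEval, listedVal]
  · intro e he
    rw [← hlift, ← hlift, hcls]
    exact ⟨[], _, by simp, Or.inr (Or.inr (Or.inr (Or.inr (Or.inr (Or.inl
      ⟨e, he, rfl, rfl⟩)))))⟩
  · rw [map_mul, map_inv, hf, hf, h, mul_inv_cancel]

end WordProblem

/-! ### Primitive recursive parts of the algorithm -/

section Algorithm

theorem VADescription.primrec_equiv :
    Primrec fun D : VADescription => (D.rank, D.index, D.quotGens, D.quotRels, D.table) :=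
  Primrec.of_equiv

theorem GrammarCode.primrec_equiv : Primrec fun g : GrammarCode => (g.start, g.rules) :=
  Primrec.of_equiv

section Comp

variable {P : Type*} [Primcodable P]

@[fun_prop]
theorem VADescription.primrec_rank {f : P → VADescription} (hf : Primrec f) :
    Primrec fun a => (f a).rank :=
  Primrec.fst.comp (VADescription.primrec_equiv.comp hf)

@[fun_prop]
theorem VADescription.primrec_table {f : P → VADescription} (hf : Primrec f) :
    Primrec fun a => (f a).table :=
  Primrec.snd.comp (Primrec.snd.comp (Primrec.snd.comp (Primrec.snd.comp
    (VADescription.primrec_equiv.comp hf))))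

@[fun_prop]
theorem GrammarCode.primrec_start {f : P → GrammarCode} (hf : Primrec f) :
    Primrec fun a => (f a).start :=
  Primrec.fst.comp (GrammarCode.primrec_equiv.comp hf)

@[fun_prop]
theorem GrammarCode.primrec_rules {f : P → GrammarCode} (hf : Primrec f) :
    Primrec fun a => (f a).rules :=
  Primrec.snd.comp (GrammarCode.primrec_equiv.comp hf)

@[fun_prop]
theorem Primrec.getD_comp {β : Type*} [Primcodable β] {f : P → List β} {g : P → ℕ} {d : β}
    (hf : Primrec f) (hg : Primrec g) : Primrec fun a => (f a).getD (g a) d :=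
  (Primrec.list_getD d).comp hf hg

@[fun_prop]
theorem primrec_liftWord {f : P → SWord BTName} (hf : Primrec f) :
    Primrec fun a => liftWord (f a) :=
  Primrec.list_map hf (g := (fun _ b => (Sum.inr b.1, b.2) : P → BTName × Bool → ListedName × Bool))
    (by unfold Primrec₂; fun_prop)

@[fun_prop]
theorem primrec_listedWord {f : P → SWord ℕ} (hf : Primrec f) :
    Primrec fun a => listedWord (f a) :=
  Primrec.list_map hf (g := (fun _ b => (Sum.inl b.1, b.2) : P → ℕ × Bool → ListedName × Bool))
    (by unfold Primrec₂; fun_prop)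

@[fun_prop]
theorem primrec_basisWord {f : P → SWord ℕ} (hf : Primrec f) :
    Primrec fun a => basisWord (f a) :=
  Primrec.list_map hf (g := (fun _ b => (Sum.inr (Sum.inl b.1), b.2) :
    P → ℕ × Bool → ListedName × Bool))
    (by unfold Primrec₂; fun_prop)

variable {N α : Type*} [Primcodable N] [Primcodable α]

@[fun_prop]
theorem primrec_formSplits {f : P → SForm N α} (hf : Primrec f) :
    Primrec fun a => formSplits (f a) := by
  have h : Primrec fun κ : SForm N α => formSplits κ := by
    refine (Primrec.list_rec (f := fun κ : SForm N α => κ) (g := fun _ => [])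
      (h := fun _ y => (y.1 :: y.2.1, [y.1], y.2.1) :: y.2.2) Primrec.id (by fun_prop)
      (by unfold Primrec₂; fun_prop)).of_eq fun κ => ?_
    induction κ with
    | nil => rfl
    | cons s κ ih => simp only [formSplits, ← ih]
  exact h.comp hf

@[fun_prop]
theorem primrec_formTriples {f : P → List (N × SForm N α)} (hf : Primrec f) :
    Primrec fun a => formTriples (f a) :=
  Primrec.list_flatMap hf (g := (fun _ r => ([Sum.inl r.1], r.2, []) :: formSplits r.2 :
    P → N × SForm N α → List (SForm N α × SForm N α × SForm N α)))
    (by unfold Primrec₂; fun_prop)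

end Comp

namespace RegularExpression

variable {P : Type*} [Primcodable P]

@[fun_prop]
theorem primrec_char {f : P → ℕ × Bool} (hf : Primrec f) : Primrec fun a => char (f a) := by
  refine Primrec.encode_iff.1 ?_
  change Primrec fun a => 4 * Nat.bit (f a).2 (f a).1 + 2
  have h1 : Primrec fun a => 2 * (f a).1 := Primrec.nat_mul.comp (by fun_prop) (by fun_prop)
  have h2 : Primrec fun a => Nat.bit (f a).2 (f a).1 :=
    (Primrec.cond (c := fun a => (f a).2) (by fun_prop) (Primrec.succ.comp h1) h1).of_eq
      fun a => by cases (f a).2 <;> rfl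
  exact Primrec.succ.comp (Primrec.succ.comp (Primrec.nat_mul.comp (Primrec.const 4) h2))

theorem primrec_pair_code {f g : P → RegularExpression (ℕ × Bool)} (hf : Primrec f)
    (hg : Primrec g) : Primrec fun a => 4 * Nat.pair (f a).toCode (g a).toCode :=
  Primrec.nat_mul.comp (Primrec.const 4)
    (Primrec₂.natPair.comp (Primrec.encode_iff.2 hf) (Primrec.encode_iff.2 hg))

@[fun_prop]
theorem primrec_plus {f g : P → RegularExpression (ℕ × Bool)} (hf : Primrec f)
    (hg : Primrec g) : Primrec fun a => plus (f a) (g a) :=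
  Primrec.encode_iff.1 (Primrec.nat_add.comp (primrec_pair_code hf hg) (Primrec.const 3))

@[fun_prop]
theorem primrec_comp {f g : P → RegularExpression (ℕ × Bool)} (hf : Primrec f)
    (hg : Primrec g) : Primrec fun a => comp (f a) (g a) :=
  Primrec.encode_iff.1 (Primrec.nat_add.comp (primrec_pair_code hf hg) (Primrec.const 4))

@[fun_prop]
theorem primrec_star {f : P → RegularExpression (ℕ × Bool)} (hf : Primrec f) :
    Primrec fun a => star (f a) :=
  Primrec.encode_iff.1 (Primrec.nat_add.comp (Primrec.nat_mul.comp (Primrec.const 4)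
    (Primrec.encode_iff.2 hf)) (Primrec.const 5))

end RegularExpression

section Expr

variable {P : Type*} [Primcodable P]

@[fun_prop]
theorem primrec_wordExpr {f : P → SWord ℕ} (hf : Primrec f) : Primrec fun a => wordExpr (f a) :=
  Primrec.list_foldr (h := fun _ (y : (ℕ × Bool) × RegularExpression (ℕ × Bool)) =>
    .comp (.char y.1) y.2) hf (Primrec.const _)
    (by unfold Primrec₂; fun_prop)

@[fun_prop]
theorem primrec_starsExpr {f : P → List (SWord ℕ)} (hf : Primrec f) :
    Primrec fun a => starsExpr (f a) :=
  Primrec.list_foldr (h := fun _ (y : SWord ℕ × RegularExpression (ℕ × Bool)) =>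
    .comp (.star (wordExpr y.1)) y.2) hf (Primrec.const _)
    (by unfold Primrec₂; fun_prop)

variable {N : Type*} [Primcodable N]

@[fun_prop]
theorem primrec_entryExpr {f : P → TableEntry N ℕ} (hf : Primrec f) :
    Primrec fun a => entryExpr (f a) := by
  unfold entryExpr
  fun_prop

@[fun_prop]
theorem primrec_tableExpr {n : P → N} {f : P → List (TableEntry N ℕ)} (hn : Primrec n)
    (hf : Primrec f) : Primrec fun a => tableExpr (n a) (f a) := by
  classical
  have h : Primrec fun a => (f a).foldr (fun e E =>
      if e.1.1 = [] ∧ e.1.2.1 = [Sum.inl (n a)] then .plus (entryExpr e) E else E)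
      (RegularExpression.zero : RegularExpression (ℕ × Bool)) := by
    refine Primrec.list_foldr (h := fun a (y : TableEntry N ℕ × RegularExpression (ℕ × Bool)) =>
      if y.1.1.1 = [] ∧ y.1.1.2.1 = [Sum.inl (n a)] then .plus (entryExpr y.1) y.2 else y.2) hf
      (Primrec.const _) ?_
    refine Primrec.ite (PrimrecPred.and (Primrec.eq.comp ?_ ?_) (Primrec.eq.comp ?_ ?_)) ?_ ?_
      <;> fun_prop
  refine h.of_eq fun a => ?_
  rw [tableExpr, List.foldr_filter]
  congr 1
  funext e E
  by_cases he : e.1.1 = [] ∧ e.1.2.1 = [Sum.inl (n a)] <;> simp [he]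

end Expr

/-! ### Semidecidability of certificates -/

/-- The premise has to be decidable, because its negation is one of the alternatives searched. -/
theorem SigmaPred.imp {P : Type*} [Primcodable P] {p q : P → Prop} (hp : PrimrecPred p)
    (hq : SigmaPred q) : SigmaPred fun a => p a → q a := by
  classical
  exact ((SigmaPred.of_primrecPred hp.not).or hq).of_eq fun a => by tauto

theorem SigmaPred.eqRule {P : Type*} [Primcodable P] {D : P → VADescription}
    {gens : P → List (SWord BTName)} {prem : P → List (SWord ListedName × SWord ListedName)}
    {j : P → SWord ListedName × SWord ListedName} (hD : Primrec D) (hgens : Primrec gens)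
    (hprem : Primrec prem) (hj : Primrec j) :
    SigmaPred fun x => EqRule (D x) (gens x) (prem x) (j x) := by
  unfold EqRule
  repeat' first
    | refine SigmaPred.or ?_ ?_
    | refine SigmaPred.and ?_ ?_
    | refine SigmaPred.ex ?_
    | refine SigmaPred.mem ?_ ?_
    | refine SigmaPred.eq ?_ ?_
    | fun_prop

theorem SigmaPred.provablyEq {P : Type*} [Primcodable P] {D : P → VADescription}
    {gens : P → List (SWord BTName)} {u v : P → SWord ListedName} (hD : Primrec D)
    (hgens : Primrec gens) (hu : Primrec u) (hv : Primrec v) :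
    SigmaPred fun x => ProvablyEq (D x) (gens x) (u x) (v x) := by
  have h := SigmaPred.derivable
    (R := fun x : VADescription × List (SWord BTName) => EqRule x.1 x.2)
    (SigmaPred.eqRule (by fun_prop) (by fun_prop) (by fun_prop) (by fun_prop))
  exact h.comp (f := fun x => ((D x, gens x), u x, v x)) (by fun_prop)

/-- Exposes the logical form, so that the closure properties of `SigmaPred` apply connective by
connective. -/
theorem isCertificate_iff {N α : Type*} (eqv : SWord α → SWord α → Prop) (inA : SWord α → Prop)
    (rules : List (N × SForm N α)) {Q : List (SWord α)} {T : List (TableEntry N α)} :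
    IsCertificate eqv inA rules Q T ↔ [] ∈ Q ∧ (∀ e ∈ T, e.1.2.2 ∈ Q) ∧
      (∀ σ ∈ Q, ∃ e, e ∈ T ∧ e.1 = (σ, [], σ) ∧ Covers eqv e σ) ∧
      (∀ σ ∈ Q, ∀ r ∈ rules, ∀ s ∈ r.2, (∃ n, s = Sum.inl n) ∨
        ∃ a, s = Sum.inr a ∧ ∃ e, e ∈ T ∧ e.1.1 = σ ∧ e.1.2.1 = [Sum.inr a] ∧
          Covers eqv e (σ ++ [a])) ∧
      (∀ t ∈ formTriples rules, ∀ e ∈ T, ∀ f ∈ T,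
        (e.1.2.1 = t.2.1 ∧ f.1.2.1 = t.2.2 ∧ e.1.2.2 = f.1.1) → ∃ g, g ∈ T ∧
          g.1 = (e.1.1, t.1, f.1.2.2) ∧ e.2.1 ⊆ g.2.1 ∧ f.2.1 ⊆ g.2.1 ∧
          ∃ l, l ⊆ g.2.1 ∧ eqv (e.2.2 ++ f.2.2) (g.2.2 ++ l.flatten)) ∧
      ∀ e ∈ T, Derivable (LowerRule eqv inA rules) (e.1, none, e.2.1, e.2.2) :=
  ⟨fun h => ⟨h.1, h.2, h.3, h.4, h.5, h.6⟩, fun h => ⟨h.1, h.2.1, h.2.2.1, h.2.2.2.1,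
    h.2.2.2.2.1, h.2.2.2.2.2⟩⟩

section

variable {P N α : Type} [Primcodable P] [Primcodable N] [Primcodable α]
  {eqv : P → SWord α → SWord α → Prop} {inA : P → SWord α → Prop}
  {rules : P → List (N × SForm N α)}
  (heqv : SigmaPred fun x : P × SWord α × SWord α => eqv x.1 x.2.1 x.2.2)
  (hinA : SigmaPred fun x : P × SWord α => inA x.1 x.2) (hrules : Primrec rules)

include heqv hinA hrules

set_option synthInstance.maxHeartbeats 200000 in
set_option synthInstance.maxSize 2048 in
theorem SigmaPred.lowerRule : SigmaPred fun x : P × List (Judgement N α) × Judgement N α =>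
    LowerRule (eqv x.1) (inA x.1) (rules x.1) x.2.1 x.2.2 := by
  have h1 : ∀ {β : Type} [Primcodable β] {a : β → P} {u v : β → SWord α}, Primrec a →
      Primrec u → Primrec v → SigmaPred fun y => eqv (a y) (u y) (v y) :=
    fun ha hu hv => heqv.comp (ha.pair (hu.pair hv))
  have h2 : ∀ {β : Type} [Primcodable β] {a : β → P} {u : β → SWord α}, Primrec a →
      Primrec u → SigmaPred fun y => inA (a y) (u y) :=
    fun ha hu => hinA.comp (ha.pair hu)
  unfold LowerRule
  repeat' first
    | refine SigmaPred.or ?_ ?_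
    | refine SigmaPred.and ?_ ?_
    | refine SigmaPred.ex ?_
    | refine SigmaPred.mem ?_ ?_
    | refine SigmaPred.subset ?_ ?_
    | refine SigmaPred.eq ?_ ?_
    | refine h1 ?_ ?_ ?_
    | refine h2 ?_ ?_
    | fun_prop

set_option synthInstance.maxHeartbeats 200000 in
set_option synthInstance.maxSize 2048 in
theorem SigmaPred.isCertificate :
    SigmaPred fun x : P × List (SWord α) × List (TableEntry N α) =>
      IsCertificate (eqv x.1) (inA x.1) (rules x.1) x.2.1 x.2.2 := by
  have h1 : ∀ {β : Type} [Primcodable β] {a : β → P} {u v : β → SWord α}, Primrec a →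
      Primrec u → Primrec v → SigmaPred fun y => eqv (a y) (u y) (v y) :=
    fun ha hu hv => heqv.comp (ha.pair (hu.pair hv))
  have h3 : ∀ {β : Type} [Primcodable β] {a : β → P} {j : β → Judgement N α}, Primrec a →
      Primrec j → SigmaPred fun y =>
        Derivable (LowerRule (eqv (a y)) (inA (a y)) (rules (a y))) (j y) :=
    fun ha hj => (SigmaPred.derivable (R := fun p => LowerRule (eqv p) (inA p) (rules p))
      (SigmaPred.lowerRule heqv hinA hrules)).comp (ha.pair hj)
  refine SigmaPred.of_eq ?_ fun x => (isCertificate_iff (eqv x.1) (inA x.1) (rules x.1)).symm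
  simp only [Covers]
  repeat' first
    | refine SigmaPred.imp (.and (Primrec.eq.comp ?_ ?_) (.and (Primrec.eq.comp ?_ ?_)
        (Primrec.eq.comp ?_ ?_))) ?_
    | refine SigmaPred.ball ?_ ?_
    | refine SigmaPred.or ?_ ?_
    | refine SigmaPred.and ?_ ?_
    | refine SigmaPred.ex ?_
    | refine SigmaPred.mem ?_ ?_
    | refine SigmaPred.subset ?_ ?_
    | refine SigmaPred.eq ?_ ?_
    | refine h1 ?_ ?_ ?_
    | refine h3 ?_ ?_
    | fun_prop

end
end Algorithm

/-! ### The algorithm -/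

section Output

/-- The words `u` and `v` over the listed elements are provably equal. -/
def ListedEq (D : VADescription) (gens : List (SWord BTName)) (u v : SWord ℕ) : Prop :=
  ProvablyEq D gens (listedWord u) (listedWord v)

/-- The word `w` over the listed elements is provably equal to a word over the basis. -/
def ListedMem (D : VADescription) (gens : List (SWord BTName)) (w : SWord ℕ) : Prop :=
  ∃ q : SWord ℕ, (∀ c ∈ q, c.1 < D.rank) ∧ ProvablyEq D gens (listedWord w) (basisWord q)

/-- All letters of `w` are less than `k`. -/
def IsWordOver (k : ℕ) (w : SWord ℕ) : Prop := ∀ c ∈ w, c.1 < k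

/-- `E` is the regular expression of a certificate for the given grammar. -/
def IsOutput (D : VADescription) (gens : List (SWord BTName)) (g : GrammarCode)
    (E : RegularExpression (ℕ × Bool)) : Prop :=
  ∃ (Q : List (SWord ℕ)) (T : List (TableEntry ℕ ℕ)),
    IsCertificate (ListedEq D gens) (ListedMem D gens) g.rules Q T ∧
    (∀ e ∈ T, IsWordOver gens.length e.2.2 ∧ IsWordOver gens.length e.1.2.2 ∧
      ∀ p ∈ e.2.1, IsWordOver gens.length p) ∧
    E = tableExpr g.start T

theorem sigmaPred_isOutput :
    SigmaPred fun x : (VADescription × List (SWord BTName) × GrammarCode) ×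
      RegularExpression (ℕ × Bool) => IsOutput x.1.1 x.1.2.1 x.1.2.2 x.2 := by
  have hcert : SigmaPred fun x : (VADescription × List (SWord BTName) × GrammarCode) ×
      List (SWord ℕ) × List (TableEntry ℕ ℕ) => IsCertificate (ListedEq x.1.1 x.1.2.1)
        (ListedMem x.1.1 x.1.2.1) x.1.2.2.rules x.2.1 x.2.2 := by
    refine SigmaPred.isCertificate
      (eqv := fun a : VADescription × List (SWord BTName) × GrammarCode => ListedEq a.1 a.2.1)
      (inA := fun a => ListedMem a.1 a.2.1) (rules := fun a => a.2.2.rules) ?_ ?_ (by fun_prop)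
    · exact SigmaPred.provablyEq (by fun_prop) (by fun_prop) (by fun_prop) (by fun_prop)
    · refine .ex (.and (.ball (.lt ?_ ?_) ?_) (.provablyEq ?_ ?_ ?_ ?_)) <;> fun_prop
  have hover : ∀ {β : Type} [Primcodable β] {k : β → ℕ} {w : β → SWord ℕ}, Primrec k →
      Primrec w → SigmaPred fun y => IsWordOver (k y) (w y) :=
    fun hk hw => .ball (.lt (by fun_prop) (by fun_prop)) hw
  refine .ex (.ex (.and ?_ (.and (.ball (.and (hover ?_ ?_) (.and (hover ?_ ?_)
    (.ball (hover ?_ ?_) ?_))) ?_) (.eq ?_ ?_))))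
  · exact hcert.comp (f := fun x : (((VADescription × List (SWord BTName) × GrammarCode) ×
      RegularExpression (ℕ × Bool)) × List (SWord ℕ)) × List (TableEntry ℕ ℕ) =>
        (x.1.1.1, x.1.2, x.2)) (by fun_prop)
  all_goals fun_prop

variable {G : Type*} [Group G] {D : VADescription} {b t : ℕ → G} (hD : D.Describes b t)
  {gens : List (SWord BTName)} (hgens : ∀ w ∈ gens, ∀ a ∈ w, D.IsName a.1)

theorem isListedWord_listedWord (D : VADescription) (w : SWord ℕ) :
    IsListedWord D (listedWord w) := by
  intro a ha
  obtain ⟨c, -, rfl⟩ := List.mem_map.1 ha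
  trivial

theorem isListedWord_basisWord {D : VADescription} {q : SWord ℕ} (hq : ∀ c ∈ q, c.1 < D.rank) :
    IsListedWord D (basisWord q) := by
  intro a ha
  obtain ⟨c, hc, rfl⟩ := List.mem_map.1 ha
  exact hq c hc

include hD hgens

/-- Identifies the formal relation with equality in `G`, which transfers the semantic theory of
certificates to the formal ones that can be searched. -/
theorem listedEq_iff (u v : SWord ℕ) : ListedEq D gens u v ↔
    wordEval (listedElement b t gens) u = wordEval (listedElement b t gens) v := by
  rw [← wordEval_listedWord, ← wordEval_listedWord]
  exact ⟨ProvablyEq.eval_eq hD, ProvablyEq.of_eval_eq hD hgens (isListedWord_listedWord D u)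
    (isListedWord_listedWord D v)⟩

theorem listedMem_iff (w : SWord ℕ) : ListedMem D gens w ↔
    wordEval (listedElement b t gens) w ∈ D.baseSubgroup b := by
  rw [← wordEval_listedWord]
  constructor
  · rintro ⟨q, hq, h⟩
    rw [ProvablyEq.eval_eq hD h, wordEval_basisWord]
    refine Subgroup.list_prod_mem _ fun y hy => ?_
    obtain ⟨c, hc, rfl⟩ := List.mem_map.1 hy
    have hc' : b c.1 ∈ D.baseSubgroup b := Subgroup.subset_closure ⟨c.1, hq c hc, rfl⟩
    split_ifs
    exacts [hc', inv_mem hc']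
  · intro h
    obtain ⟨q, hq, hq'⟩ := exists_word_of_mem_closure h
    exact ⟨q, hq, ProvablyEq.of_eval_eq hD hgens (isListedWord_listedWord D w)
      (isListedWord_basisWord hq) (by rw [← hq', wordEval_basisWord])⟩

theorem listedEq_eq : ListedEq D gens = fun u v =>
    wordEval (listedElement b t gens) u = wordEval (listedElement b t gens) v :=
  funext fun u => funext fun v => propext (listedEq_iff hD hgens u v)

theorem listedMem_eq : ListedMem D gens = fun w =>
    wordEval (listedElement b t gens) w ∈ D.baseSubgroup b :=
  funext fun w => propext (listedMem_iff hD hgens w)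

variable (g : GrammarCode)

theorem exists_isOutput
    (htop : Subgroup.closure (listedElement b t gens '' Set.Iio gens.length) = ⊤) :
    ∃ E, IsOutput D gens g E := by
  have := hD.finiteIndex
  obtain ⟨Q, T, hC, hT⟩ := exists_certificate (x := listedElement b t gens)
    hD.baseSubgroup_comm (ok := IsWordOver gens.length) (by simp [IsWordOver])
    (fun h => exists_word_of_mem_closure (s := Set.Iio gens.length) (htop ▸ Subgroup.mem_top h))
    g.rules
  exact ⟨_, Q, T, by rwa [listedEq_eq hD hgens, listedMem_eq hD hgens], hT, rfl⟩

variable {g} {E : RegularExpression (ℕ × Bool)} (hE : IsOutput D gens g E)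

include hE

omit hD hgens in
theorem IsOutput.isWordOver {w : SWord ℕ} (hw : w ∈ E.matches') :
    IsWordOver gens.length w := by
  obtain ⟨Q, T, -, hT, rfl⟩ := hE
  obtain ⟨e, he, -, hw⟩ := mem_tableExpr.1 hw
  obtain ⟨v, hv, rfl⟩ := mem_entryExpr.1 hw
  obtain ⟨l, hl, rfl⟩ := exists_of_mem_starsExpr hv
  obtain ⟨h1, h2, h3⟩ := hT e he
  intro c hc
  simp only [List.mem_append, List.mem_flatten] at hc
  rcases hc with hc | ⟨p, hp, hc⟩ | hc
  exacts [h1 c hc, h3 p (hl hp) c hc, h2 c hc]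

theorem IsOutput.image_eq : wordEval (listedElement b t gens) '' (E.matches' : Set (SWord ℕ)) =
    wordEval (listedElement b t gens) '' (g.toGrammar.language : Set (SWord ℕ)) := by
  obtain ⟨Q, T, hC, -, rfl⟩ := hE
  rw [listedEq_eq hD hgens, listedMem_eq hD hgens] at hC
  rw [image_tableExpr hD.baseSubgroup_comm hC]
  have hR : ∀ r : ContextFreeRule (ℕ × Bool) ℕ, r ∈ (g.rules.map fun p =>
      (⟨p.1, formSymbols p.2⟩ : ContextFreeRule (ℕ × Bool) ℕ)).toFinset ↔
      ∃ p ∈ g.rules, r = ⟨p.1, formSymbols p.2⟩ := fun r => by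
    simp only [List.mem_toFinset, List.mem_map, eq_comm]
  exact (image_language_eq (C := g.toGrammar) (rules := g.rules) hR).symm

end Output

theorem mainTheorem5 :
    -- every context-free subset of a finitely generated virtually abelian group is rational
    (∀ (G : Type u) [Group G] (ι : Type v) [Finite ι] (x : ι → G),
      IsVirtuallyAbelian G → Subgroup.closure (Set.range x) = ⊤ →
      ∀ C : Set G, IsContextFreeSubset x C → IsRationalSubset x C) ∧
    -- one algorithm turns group descriptions, generating sets and grammars into expressions
    (∃ F : VADescription × List (SWord BTName) × GrammarCode →. RegularExpression (ℕ × Bool),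
      Partrec F ∧
      ∀ (D : VADescription) (gens : List (SWord BTName)) (g : GrammarCode)
        (G : Type u) [Group G] (b t : ℕ → G),
        D.Describes b t →
        (∀ w ∈ gens, ∀ a ∈ w, D.IsName a.1) →
        Subgroup.closure (listedElement b t gens '' Set.Iio gens.length) = ⊤ →
        g.IsOver gens.length →
        ∃ E ∈ F (D, gens, g),
          (∀ w ∈ E.matches', ∀ a ∈ w, a.1 < gens.length) ∧
          wordEval (listedElement b t gens) '' (E.matches' : Set (SWord ℕ)) =
            wordEval (listedElement b t gens) '' (g.toGrammar.language : Set (SWord ℕ))) := by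
  refine ⟨fun G _ ι _ x hG hx C hC => isRationalSubset_of_isContextFreeSubset hG hx hC, ?_⟩
  -- `IsOutput` mentions only the finite data, so one search procedure serves all groups; a
  -- described group enters only in proving that the search halts and that its result is correct.
  obtain ⟨F, hF, hsound, hcomplete⟩ := SigmaPred.exists_partrec (p :=
    fun a : VADescription × List (SWord BTName) × GrammarCode => IsOutput a.1 a.2.1 a.2.2)
    sigmaPred_isOutput
  refine ⟨F, hF, fun D gens g G _ b t hD hgens htop _ => ?_⟩
  obtain ⟨E, hE⟩ := hcomplete (D, gens, g) (exists_isOutput hD hgens g htop)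
  have hE' : IsOutput D gens g E := hsound _ E hE
  exact ⟨E, hE, fun w hw => hE'.isWordOver hw, hE'.image_eq hD hgens⟩
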